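/- Let $(\epsilon_n)_{n\ge 1}$ be any sequence of positive numbers with $\epsilon_n\to 0$. Then there exist a weight $w$, i.e. a function $w\in L^1(\mathbb{R})$ with $w(x)>0$ for almost every $x$, and a sequence $\Lambda=\{\lambda_n\}_{n\ge1}$ of positive real numbers that is uniformly discrete, i.e. $\inf_{m\ne n}|\lambda_m-\lambda_n|>0$, such that (i) $\dfrac{\lambda_{n+1}}{\lambda_n}>1+\epsilon_n$ for every $n$; (ii) the system of exponentials $E(\Lambda)=\{e^{i\lambda x}\}_{\lambda\in\Lambda}$ is a $(QF)$-system in the weighted space $L^2_w(\mathbb{R})$ of complex functions $f$ with $\int_{\mathbb{R}}|f(x)|^2w(x)\,dx<\infty$, with scalar product $\langle f,g\rangle=\int_{\mathbb{R}} f(x)\overline{g(x)}\,w(x)\,dx$. Here a system of vectors $\{u_n\}$ in a Hilbert space $H$ is called a $(QF)$-system if the following two conditions hold: (a) for every $q>2$ there is a constant $C(q)$ such that for every $f\in H$ and every $\epsilon>0$ there is a finite linear combination $Q=\sum c_nu_n$ with $\|f-Q\|<\epsilon$ and $\left(\sum|c_n|^q\right)^{1/q}\le C(q)\,\|f\|$;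 (b) (Bessel inequality) there is a constant $C'$ such that $\left(\sum|\langle f,u_n\rangle|^2\right)^{1/2}\le C'\|f\|$ for all $f\in H$. -/

import Mathlib

/-!
A Riesz product `h = ∏_{k < m} (1 + b Re z^(3^k))` has constant term `1`, and its other coefficients
have `q`-th power sum `(1 + 2 (b/2)^q)^m - 1`, while the mean of `√h` is at most `(1 - b²/32)^m`.
Taking `b` small with `m b²` large and `m b^q` small, `1 - h` has tiny `ℓ_q` coefficient sum for a
given `q > 2` and is close to `1` off a small set. Multiplying it by `z^N P₀(z^N)`, where `z P₀(z)`
is close to `1` off a small set and `N` exceeds the degree of `h`, makes it analytic. So there are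
polynomials `P_k` with `z P_k(z)` converging to `1` off small sets, whose `ℓ_q` coefficient sums
tend to `0` for every `q > 2`.

Substituting `z = e^{2πiLx}` approximates `e^{2πisx}` by a combination of the exponentials with
frequencies `s + L, s + 2L, …, s + ML`, as accurately as one likes in `L²_w` once the weight is
divided by the supremum of the squared errors, rescaled by the required accuracies; this supremum
is finite almost everywhere by Borel–Cantelli. Inside such a block the ratios of consecutive
frequencies stay above `1 + 1/M`, so the growth condition holds for blocks placed late enough, with
`L` as large as needed. Running `s` through a dense sequence, each term infinitely often, gives
completeness with small coefficients. Finally, since the weight lies below a Gaussian, the Gram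
matrix of separated exponentials decays fast off the diagonal and Schur's test gives the Bessel
inequality.
-/

open MeasureTheory Filter Topology

/-- A set of real numbers is uniformly discrete if its distinct points are separated by some
`δ > 0`. -/
def UniformlyDiscrete (S : Set ℝ) : Prop :=
  ∃ δ : ℝ, 0 < δ ∧ ∀ x ∈ S, ∀ y ∈ S, x ≠ y → δ ≤ |x - y|

/-- `(QF)`-systems in a complex Hilbert space: (i) completeness with `ℓ_q` estimate of the
coefficients for every `q > 2`; (ii) the Bessel inequality. -/
def IsQFSystem {ι H : Type*} [NormedAddCommGroup H] [InnerProductSpace ℂ H] (u : ι → H) : Prop :=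
  (∀ q : ℝ, 2 < q → ∃ C : ℝ, ∀ f : H, ∀ ε : ℝ, 0 < ε → ∃ c : ι →₀ ℂ,
      ‖f - ∑ n ∈ c.support, c n • u n‖ < ε ∧
      (∑ n ∈ c.support, ‖c n‖ ^ q) ^ (1 / q) ≤ C * ‖f‖) ∧
  (∃ C' : ℝ, ∀ f : H, Summable (fun n => ‖inner ℂ f (u n)‖ ^ 2) ∧
      Real.sqrt (∑' n, ‖inner ℂ f (u n)‖ ^ 2) ≤ C' * ‖f‖)

/-- A weight: an integrable function on `ℝ` that is strictly positive almost everywhere. -/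
structure IsWeight (w : ℝ → ℝ) : Prop where
  integrable : Integrable w volume
  pos : ∀ᵐ x ∂(volume : Measure ℝ), 0 < w x

/-- The measure `w(x) dx`. -/
noncomputable def weightMeasure (w : ℝ → ℝ) : Measure ℝ :=
  (volume : Measure ℝ).withDensity (fun x => ENNReal.ofReal (w x))

/-- The weighted space `L²_w(ℝ)` of complex functions, with its Hilbert space structure. -/
noncomputable abbrev WeightedL2 (w : ℝ → ℝ) : Type := Lp ℂ 2 (weightMeasure w)

theorem IsWeight.isFiniteMeasure {w : ℝ → ℝ} (hw : IsWeight w) :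
    IsFiniteMeasure (weightMeasure w) :=
  isFiniteMeasure_withDensity_ofReal hw.integrable.2

theorem IsWeight.memLp_exp {w : ℝ → ℝ} (hw : IsWeight w) (l : ℝ) :
    MemLp (fun x : ℝ => Complex.exp (Complex.I * (l : ℂ) * (x : ℂ))) 2 (weightMeasure w) := by
  haveI := hw.isFiniteMeasure
  refine MemLp.of_bound (C := 1) (Continuous.aestronglyMeasurable (by fun_prop)) ?_
  refine Eventually.of_forall fun x => ?_
  rw [Complex.norm_exp]
  simp

/-- The exponential `x ↦ e^{i l x}` as an element of `L²_w(ℝ)`. -/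
noncomputable def expL2 {w : ℝ → ℝ} (hw : IsWeight w) (l : ℝ) : WeightedL2 w :=
  (hw.memLp_exp l).toLp (fun x : ℝ => Complex.exp (Complex.I * (l : ℂ) * (x : ℂ)))
section AnalyticPolynomials

open Polynomial

/-- The arithmetic mean of the first `n` partial sums of the geometric series. -/
noncomputable def geomMean (n : ℕ) : ℂ[X] :=
  C (n : ℂ)⁻¹ * ∑ t ∈ Finset.range n, ∑ j ∈ Finset.range (t + 1), X ^ j

theorem eval_zero_geomMean {n : ℕ} (hn : n ≠ 0) : (geomMean n).eval 0 = 1 := by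
  simp [geomMean, eval_finsetSum, Finset.sum_range_succ', hn]

theorem eval_geomMean_sub {n : ℕ} (hn : n ≠ 0) {z : ℂ} (hz : z ≠ 1) :
    (geomMean n).eval z - (1 - z)⁻¹ = z * (z ^ n - 1) / (n * (z - 1) ^ 2) := by
  have hz' : z - 1 ≠ 0 := sub_ne_zero.2 hz
  have hmean : (geomMean n).eval z
      = (n : ℂ)⁻¹ * ∑ t ∈ Finset.range n, (z * z ^ t - 1) / (z - 1) := by
    simp [geomMean, eval_finsetSum, geom_sum_eq hz, pow_succ']
  rw [hmean, ← Finset.sum_div, Finset.sum_sub_distrib, ← Finset.mul_sum, geom_sum_eq hz,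
    ← neg_sub z 1, inv_neg]
  simp only [Finset.sum_const, Finset.card_range, nsmul_eq_mul, mul_one]
  field_simp
  ring

theorem norm_eval_geomMean_sub_le {n : ℕ} (hn : n ≠ 0) {z : ℂ} (hz : ‖z‖ = 1) (hz1 : z ≠ 1) :
    ‖(geomMean n).eval z - (1 - z)⁻¹‖ ≤ 2 / (n * ‖z - 1‖ ^ 2) := by
  have hnum : ‖z ^ n - 1‖ ≤ 2 := (norm_sub_le _ _).trans (by simp [hz, one_add_one_eq_two])
  rw [eval_geomMean_sub hn hz1, norm_div, norm_mul, norm_mul, hz, norm_pow, Complex.norm_natCast,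
    one_mul]
  gcongr

theorem re_inv_one_sub {z : ℂ} (hz : ‖z‖ = 1) (hz1 : z ≠ 1) : ((1 - z)⁻¹).re = 1 / 2 := by
  have hne : Complex.normSq (1 - z) ≠ 0 := by simpa [sub_eq_zero] using hz1.symm
  have hone : Complex.normSq z = 1 := by simp [Complex.normSq_eq_norm_sq, hz]
  rw [Complex.inv_re, div_eq_iff hne]
  simp only [Complex.normSq_apply, Complex.sub_re, Complex.sub_im, Complex.one_re,
    Complex.one_im] at hone ⊢
  linarith

theorem exists_eval_zero_eq_zero_and_re_ge {ρ : ℝ} (hρ : 0 < ρ) :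
    ∃ h : ℂ[X], h.eval 0 = 0 ∧ ∀ z : ℂ, ‖z‖ = 1 → ρ ≤ ‖z - 1‖ → 1 / 4 ≤ (h.eval z).re := by
  obtain ⟨n, hn⟩ := exists_nat_gt (8 / ρ ^ 2)
  have hn0 : (0 : ℝ) < n := lt_of_le_of_lt (by positivity) hn
  have hn1 : n ≠ 0 := by exact_mod_cast hn0.ne'
  refine ⟨1 - geomMean n, by simp [eval_zero_geomMean hn1], fun z hz hz1 => ?_⟩
  have hne : z ≠ 1 := by
    rintro rfl
    simp at hz1
    linarith
  have hsmall : 2 / (n * ‖z - 1‖ ^ 2) ≤ 1 / 4 := by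
    have hz0 : 0 < ‖z - 1‖ := hρ.trans_le hz1
    rw [div_lt_iff₀ (by positivity)] at hn
    rw [div_le_iff₀ (by positivity)]
    have : ρ ^ 2 ≤ ‖z - 1‖ ^ 2 := by gcongr
    nlinarith
  have hre := (Complex.abs_re_le_norm _).trans
    ((norm_eval_geomMean_sub_le hn1 hz hne).trans hsmall)
  rw [Complex.sub_re, re_inv_one_sub hz hne, abs_le] at hre
  simp only [eval_sub, eval_one, Complex.sub_re, Complex.one_re]
  linarith [hre.2]

theorem norm_one_sub_smul_sq_le {t B : ℝ} (ht : 0 ≤ t) (htB : t * B ^ 2 ≤ 1 / 4) {a : ℂ}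
    (ha : 1 / 4 ≤ a.re) (haB : ‖a‖ ≤ B) : ‖1 - t • a‖ ^ 2 ≤ 1 - t / 4 := by
  have hexp : ‖1 - t • a‖ ^ 2 = 1 - 2 * (t * a.re) + t * (t * ‖a‖ ^ 2) := by
    rw [← Complex.normSq_eq_norm_sq, ← Complex.normSq_eq_norm_sq]
    simp [Complex.normSq_apply]
    ring
  have hsq : t * ‖a‖ ^ 2 ≤ 1 / 4 := le_trans (by gcongr) htB
  rw [hexp]
  nlinarith [mul_le_mul_of_nonneg_left ha ht, mul_le_mul_of_nonneg_left hsq ht]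

theorem exists_norm_mul_eval_sub_one_lt {K : Set ℂ} (hK : IsClosed K)
    (hKs : K ⊆ Metric.sphere 0 1) (h1 : (1 : ℂ) ∉ K) {δ : ℝ} (hδ : 0 < δ) :
    ∃ P : ℂ[X], ∀ z ∈ K, ‖z * P.eval z - 1‖ < δ := by
  obtain ⟨ρ, hρ, hball⟩ := Metric.isOpen_iff.1 hK.isOpen_compl 1 h1
  obtain ⟨h, h0, hre⟩ := exists_eval_zero_eq_zero_and_re_ge hρ
  obtain ⟨B, hB⟩ := ((isCompact_sphere (0 : ℂ) 1).of_isClosed_subset hK hKs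
    ).exists_bound_of_continuousOn h.continuous.continuousOn
  set t : ℝ := 1 / (4 * (B ^ 2 + 1)) with ht
  have ht0 : 0 < t := by positivity
  have htB : t * B ^ 2 ≤ 1 / 4 := by
    rw [ht, div_mul_eq_mul_div, div_le_div_iff₀ (by positivity) (by positivity)]
    linarith
  obtain ⟨a, ha⟩ := exists_pow_lt_of_lt_one hδ (show 1 - t / 4 < 1 by linarith)
  have hX : (X : ℂ[X]) ∣ 1 - (1 - C (t : ℂ) * h) ^ (2 * a) := by
    rw [X_dvd_iff, coeff_zero_eq_eval_zero]
    simp [h0]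
  obtain ⟨P, hP⟩ := hX
  refine ⟨P, fun z hz => ?_⟩
  have hfar : ρ ≤ ‖z - 1‖ := by
    by_contra! hlt
    exact hball (by rwa [Metric.mem_ball, dist_eq_norm]) hz
  have heval : z * P.eval z - 1 = -(1 - t • h.eval z) ^ (2 * a) := by
    have := congrArg (eval z) hP
    simp only [eval_sub, eval_one, eval_pow, eval_mul, eval_C, eval_X] at this
    rw [← this, Complex.real_smul]
    ring
  calc ‖z * P.eval z - 1‖ = (‖1 - t • h.eval z‖ ^ 2) ^ a := by
        rw [heval, norm_neg, norm_pow, pow_mul]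
    _ ≤ (1 - t / 4) ^ a := by
        gcongr
        exact norm_one_sub_smul_sq_le ht0.le htB (hre z (by simpa using hKs hz) hfar) (hB z hz)
    _ < δ := ha

end AnalyticPolynomials

section Circle

open Polynomial

theorem norm_fourier_apply {T : ℝ} (n : ℤ) (θ : AddCircle T) : ‖fourier n θ‖ = 1 := by
  rw [fourier_apply, Circle.norm_coe]

theorem fourier_natCast_apply {T : ℝ} (n : ℕ) (θ : AddCircle T) :
    fourier n θ = fourier 1 θ ^ n := by
  simp [fourier_apply, AddCircle.toCircle_nsmul]

theorem fourier_one_nsmul {T : ℝ} (n : ℕ) (θ : AddCircle T) :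
    fourier 1 (n • θ) = fourier 1 θ ^ n := by
  simp [fourier_apply, AddCircle.toCircle_nsmul]

theorem fourier_one_ne_one {T : ℝ} [hT : Fact (0 < T)] {θ : AddCircle T} (hθ : θ ≠ 0) :
    fourier 1 θ ≠ 1 := fun h =>
  hθ (AddCircle.injective_toCircle hT.out.ne' (Circle.ext (by simpa [fourier_one] using h)))

theorem measurePreserving_nsmul_addCircle {T : ℝ} [Fact (0 < T)] {K : ℕ} (hK : K ≠ 0) :
    MeasurePreserving (fun θ : AddCircle T => K • θ) := by
  simpa using
    Measure.measurePreserving_zsmul (volume : Measure (AddCircle T)) (Int.natCast_ne_zero.2 hK)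

theorem integral_comp_nsmul {T : ℝ} [Fact (0 < T)] {K : ℕ} (hK : K ≠ 0) {g : AddCircle T → ℝ}
    (hg : Continuous g) : ∫ θ : AddCircle T, g (K • θ) = ∫ θ : AddCircle T, g θ := by
  have hmp := measurePreserving_nsmul_addCircle (T := T) hK
  rw [← integral_map hmp.measurable.aemeasurable hg.aestronglyMeasurable, hmp.map_eq]

theorem exists_volume_norm_mul_eval_sub_one_lt {δ : ℝ} (hδ : 0 < δ) :
    ∃ P : ℂ[X], volume {θ : UnitAddCircle | δ < ‖fourier 1 θ * P.eval (fourier 1 θ) - 1‖}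
      < ENNReal.ofReal δ := by
  set U : Set UnitAddCircle := Metric.ball 0 (δ / 3)
  have hK : IsCompact (fourier 1 '' Uᶜ : Set ℂ) :=
    Metric.isOpen_ball.isClosed_compl.isCompact.image (map_continuous _)
  have h1 : (1 : ℂ) ∉ (fourier 1 '' Uᶜ : Set ℂ) := by
    rintro ⟨θ, hθ, h⟩
    refine fourier_one_ne_one ?_ h
    rintro rfl
    exact hθ (Metric.mem_ball_self (by positivity))
  obtain ⟨P, hP⟩ := exists_norm_mul_eval_sub_one_lt hK.isClosed
    (Set.image_subset_iff.2 fun θ _ => mem_sphere_zero_iff_norm.2 (norm_fourier_apply 1 θ)) h1 hδ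
  refine ⟨P, ?_⟩
  have hsub : {θ : UnitAddCircle | δ < ‖fourier 1 θ * P.eval (fourier 1 θ) - 1‖}
      ⊆ Metric.closedBall 0 (δ / 3) := fun θ hθ => by
    by_contra hc
    exact (hP _ ⟨θ, fun h => hc (Metric.ball_subset_closedBall h), rfl⟩).not_gt hθ
  calc _ ≤ volume (Metric.closedBall (0 : UnitAddCircle) (δ / 3)) := measure_mono hsub
    _ ≤ ENNReal.ofReal (2 * (δ / 3)) := by
        rw [AddCircle.volume_closedBall]
        exact ENNReal.ofReal_le_ofReal (min_le_right _ _)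
    _ < ENNReal.ofReal δ := (ENNReal.ofReal_lt_ofReal_iff hδ).2 (by linarith)

end Circle

section CoefficientSums

open Polynomial

variable {𝕜 : Type*} [NormedField 𝕜] {q : ℝ}

/-- The sum `∑ |a|^q` over the coefficients `a` of a polynomial, the `q`-th power of their
`ℓ_q` norm. -/
noncomputable def lqSum (q : ℝ) (P : 𝕜[X]) : ℝ :=
  P.sum fun _ a => ‖a‖ ^ q

theorem lqSum_nonneg (P : 𝕜[X]) : 0 ≤ lqSum q P :=
  Finset.sum_nonneg fun _ _ => by positivity

theorem lqSum_eq_sum_range (hq : q ≠ 0) {P : 𝕜[X]} {n : ℕ} (hn : P.natDegree < n) :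
    lqSum q P = ∑ i ∈ Finset.range n, ‖P.coeff i‖ ^ q :=
  P.sum_over_range' (fun _ => by rw [norm_zero, Real.zero_rpow hq]) n hn

theorem lqSum_X_pow_mul (hq : q ≠ 0) (d : ℕ) (P : 𝕜[X]) : lqSum q (X ^ d * P) = lqSum q P := by
  have hdeg : (X ^ d * P).natDegree < d + (P.natDegree + 1) := by
    have := natDegree_mul_le_of_le (natDegree_X_pow_le (R := 𝕜) d) (le_refl P.natDegree)
    omega
  rw [lqSum_eq_sum_range hq hdeg, Finset.sum_range_add,
    Finset.sum_eq_zero fun i hi => ?_, zero_add, lqSum_eq_sum_range hq P.natDegree.lt_succ_self]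
  · simp [coeff_X_pow_mul']
  · rw [coeff_X_pow_mul', if_neg (by simpa using hi), norm_zero, Real.zero_rpow hq]

theorem lqSum_sub_of_coeff_eq_one (hq : q ≠ 0) {P : 𝕜[X]} {d : ℕ} (hd : P.coeff d = 1) :
    lqSum q (X ^ d - P) = lqSum q P - 1 := by
  have hle : d ≤ P.natDegree := le_natDegree_of_ne_zero (by simp [hd])
  have hdeg : (X ^ d - P).natDegree < P.natDegree + 1 :=
    Nat.lt_succ_of_le <| (natDegree_sub_le _ _).trans <|
      max_le ((natDegree_X_pow_le d).trans hle) le_rfl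
  have hmem : d ∈ Finset.range (P.natDegree + 1) := Finset.mem_range.2 (Nat.lt_succ_of_le hle)
  rw [lqSum_eq_sum_range hq hdeg, lqSum_eq_sum_range hq P.natDegree.lt_succ_self,
    ← Finset.add_sum_erase _ _ hmem, ← Finset.add_sum_erase _ _ hmem, hd]
  simp only [coeff_sub, coeff_X_pow, if_true, hd, sub_self, norm_zero, Real.zero_rpow hq, norm_one,
    Real.one_rpow, zero_add, add_sub_cancel_left]
  refine Finset.sum_congr rfl fun i hi => ?_
  rw [if_neg (Finset.ne_of_mem_erase hi), zero_sub, norm_neg]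

theorem coeff_mul_expand {R : Type*} [CommSemiring R] {A : R[X]} {K i : ℕ} (hA : A.natDegree < K)
    (hi : i < K) (B : R[X]) (j : ℕ) :
    (A * expand R K B).coeff (K * j + i) = A.coeff i * B.coeff j := by
  induction B using Polynomial.induction_on' with
  | add B B' hB hB' => simp only [map_add, mul_add, coeff_add, hB, hB']
  | monomial n r =>
    rw [expand_monomial, ← C_mul_X_pow_eq_monomial, ← mul_assoc, coeff_mul_X_pow', coeff_mul_C,
      coeff_monomial, mul_comm n]
    rcases lt_trichotomy n j with h | rfl | h
    · have hlt : A.natDegree < K * j + i - K * n := by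
        have := Nat.mul_le_mul_left K h
        rw [Nat.mul_succ] at this
        omega
      rw [coeff_eq_zero_of_natDegree_lt hlt, if_neg h.ne, zero_mul, mul_zero, ite_self]
    · rw [if_pos (Nat.le_add_right _ _), if_pos rfl, Nat.add_sub_cancel_left]
    · have := Nat.mul_le_mul_left K h
      rw [Nat.mul_succ] at this
      rw [if_neg (by omega), if_neg h.ne', mul_zero]

theorem sum_range_mul_add {M : Type*} [AddCommMonoid M] (f : ℕ → M) (K n : ℕ) :
    ∑ l ∈ Finset.range (K * n), f l
      = ∑ j ∈ Finset.range n, ∑ i ∈ Finset.range K, f (K * j + i) := by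
  induction n with
  | zero => simp
  | succ n ih => rw [Nat.mul_succ, Finset.sum_range_add, ih, Finset.sum_range_succ]

theorem lqSum_mul_expand (hq : q ≠ 0) {A : 𝕜[X]} {K : ℕ} (hA : A.natDegree < K) (B : 𝕜[X]) :
    lqSum q (A * expand 𝕜 K B) = lqSum q A * lqSum q B := by
  have hdeg : (A * expand 𝕜 K B).natDegree < K * (B.natDegree + 1) := by
    have := natDegree_mul_le (p := A) (q := expand 𝕜 K B)
    rw [natDegree_expand, mul_comm B.natDegree] at this
    rw [Nat.mul_succ]
    omega
  rw [lqSum_eq_sum_range hq hdeg, sum_range_mul_add, lqSum_eq_sum_range hq hA,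
    lqSum_eq_sum_range hq B.natDegree.lt_succ_self, Finset.sum_mul_sum, Finset.sum_comm]
  refine Finset.sum_congr rfl fun i hi => Finset.sum_congr rfl fun j _ => ?_
  rw [coeff_mul_expand hA (Finset.mem_range.1 hi), norm_mul,
    Real.mul_rpow (norm_nonneg _) (norm_nonneg _)]

end CoefficientSums

section RieszPolynomials

open Polynomial

/-- The polynomial `z (1 + b Re z)`, for `z` on the unit circle. -/
noncomputable def rieszFactor (b : ℝ) : ℂ[X] :=
  C (b / 2 : ℂ) + X + C (b / 2 : ℂ) * X ^ 2

/-- The Riesz product `∏_{k < m} (1 + b Re z^(3^k))`. -/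
def rieszProduct (b : ℝ) : ℕ → ℂ → ℝ
  | 0, _ => 1
  | m + 1, z => (1 + b * z.re) * rieszProduct b m (z ^ 3)

/-- The Riesz product as an analytic polynomial, multiplied by `z ^ rieszCenter m`. -/
noncomputable def rieszPolynomial (b : ℝ) : ℕ → ℂ[X]
  | 0 => 1
  | m + 1 => rieszFactor b * expand ℂ 3 (rieszPolynomial b m)

/-- The number `(3 ^ m - 1) / 2`, the position of the constant term of the Riesz product among the
coefficients of `rieszPolynomial b m`. -/
def rieszCenter : ℕ → ℕ
  | 0 => 0
  | m + 1 => 3 * rieszCenter m + 1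

theorem coeff_rieszFactor (b : ℝ) :
    (rieszFactor b).coeff 0 = b / 2 ∧ (rieszFactor b).coeff 1 = 1 ∧
      (rieszFactor b).coeff 2 = b / 2 := by
  simp [rieszFactor, coeff_X]

theorem natDegree_rieszFactor_le (b : ℝ) : (rieszFactor b).natDegree ≤ 2 := by
  unfold rieszFactor
  compute_degree

theorem eval_rieszFactor (b : ℝ) {z : ℂ} (hz : ‖z‖ = 1) :
    (rieszFactor b).eval z = z * (1 + b * z.re : ℝ) := by
  have hconj : z * (starRingEnd ℂ) z = 1 := by rw [Complex.mul_conj']; simp [hz]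
  have hre : (z.re : ℂ) = (z + (starRingEnd ℂ) z) / 2 := by
    rw [Complex.add_conj]
    push_cast
    ring
  simp only [rieszFactor, eval_add, eval_mul, eval_C, eval_X, eval_pow]
  push_cast
  rw [hre]
  linear_combination (-(b : ℂ) / 2) * hconj

theorem lqSum_rieszFactor {b q : ℝ} (hb : 0 ≤ b) (hq : q ≠ 0) :
    lqSum q (rieszFactor b) = 1 + 2 * (b / 2) ^ q := by
  have hnorm : ‖(b / 2 : ℂ)‖ = b / 2 := by simp [abs_of_nonneg hb]
  obtain ⟨h0, h1, h2⟩ := coeff_rieszFactor b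
  rw [lqSum_eq_sum_range hq (Nat.lt_succ_of_le (natDegree_rieszFactor_le b))]
  simp only [Finset.sum_range_succ, Finset.sum_range_zero, h0, h1, h2, hnorm, norm_one,
    Real.one_rpow]
  ring

theorem natDegree_rieszPolynomial_le (b : ℝ) (m : ℕ) :
    (rieszPolynomial b m).natDegree ≤ 2 * rieszCenter m := by
  induction m with
  | zero => simp [rieszPolynomial]
  | succ m ih =>
    have := natDegree_mul_le (p := rieszFactor b) (q := expand ℂ 3 (rieszPolynomial b m))
    rw [natDegree_expand] at this
    have := natDegree_rieszFactor_le b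
    simp only [rieszPolynomial, rieszCenter]
    omega

theorem coeff_rieszPolynomial_rieszCenter (b : ℝ) (m : ℕ) :
    (rieszPolynomial b m).coeff (rieszCenter m) = 1 := by
  induction m with
  | zero => simp [rieszPolynomial, rieszCenter]
  | succ m ih =>
    rw [rieszPolynomial, rieszCenter,
      coeff_mul_expand (Nat.lt_succ_of_le (natDegree_rieszFactor_le b)) (by norm_num), ih,
      (coeff_rieszFactor b).2.1, one_mul]

theorem eval_rieszPolynomial (b : ℝ) (m : ℕ) {z : ℂ} (hz : ‖z‖ = 1) :
    (rieszPolynomial b m).eval z = z ^ rieszCenter m * rieszProduct b m z := by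
  induction m generalizing z with
  | zero => simp [rieszPolynomial, rieszCenter, rieszProduct]
  | succ m ih =>
    rw [rieszPolynomial, eval_mul, expand_eval, eval_rieszFactor b hz, ih (by simp [hz]),
      rieszProduct, rieszCenter]
    push_cast
    ring

theorem lqSum_rieszPolynomial {b q : ℝ} (hb : 0 ≤ b) (hq : q ≠ 0) (m : ℕ) :
    lqSum q (rieszPolynomial b m) = (1 + 2 * (b / 2) ^ q) ^ m := by
  induction m with
  | zero => simp [rieszPolynomial, lqSum_eq_sum_range hq (n := 1)]
  | succ m ih =>
    rw [rieszPolynomial, lqSum_mul_expand hq (Nat.lt_succ_of_le (natDegree_rieszFactor_le b)),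
      lqSum_rieszFactor hb hq, ih, pow_succ']

end RieszPolynomials

section RieszSmallness

open Polynomial

theorem integral_fourier_mul_comp_nsmul_eq_zero {T : ℝ} [hT : Fact (0 < T)] {K : ℕ} (hK : K ≠ 0)
    {n : ℤ} (hn : ¬ (K : ℤ) ∣ n) (g : AddCircle T → ℂ) :
    ∫ θ : AddCircle T, fourier n θ * g (K • θ) = 0 := by
  set τ : AddCircle T := ((T / K : ℝ) : AddCircle T)
  have horder : addOrderOf τ = K := AddCircle.addOrderOf_period_div (Nat.pos_of_ne_zero hK)
  have hτK : K • τ = 0 := by rw [← horder, addOrderOf_nsmul_eq_zero]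
  have hτn : fourier n τ ≠ 1 := fun h => hn <| by
    rw [← horder, addOrderOf_dvd_iff_zsmul_eq_zero]
    exact AddCircle.injective_toCircle hT.out.ne' (Circle.ext (by simpa [fourier_apply] using h))
  have htranslate : ∫ θ : AddCircle T, fourier n θ * g (K • θ)
      = fourier n τ * ∫ θ : AddCircle T, fourier n θ * g (K • θ) := by
    rw [← integral_const_mul, ← integral_add_right_eq_self _ τ]
    refine integral_congr_ae (Eventually.of_forall fun θ => ?_)
    simp only [smul_add, hτK, add_zero, fourier_apply, AddCircle.toCircle_add, Circle.coe_mul]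
    ring
  by_contra h
  exact hτn (mul_right_cancel₀ h (by rw [one_mul, ← htranslate]))

theorem integral_re_fourier_mul_comp_nsmul_eq_zero {T : ℝ} [Fact (0 < T)] {K : ℕ} (hK : K ≠ 0)
    {n : ℤ} (hn : ¬ (K : ℤ) ∣ n) {g : AddCircle T → ℝ} (hg : Continuous g) :
    ∫ θ : AddCircle T, (fourier n θ).re * g (K • θ) = 0 := by
  have hint : Integrable fun θ : AddCircle T => fourier n θ * (g (K • θ) : ℂ) :=
    Continuous.integrable_of_hasCompactSupport (by fun_prop) (HasCompactSupport.of_compactSpace _)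
  have hre := integral_re hint
  rw [integral_fourier_mul_comp_nsmul_eq_zero hK hn fun θ => (g θ : ℂ)] at hre
  simpa using hre

theorem sqrt_one_add_le {x : ℝ} (hx : |x| ≤ 1) : √(1 + x) ≤ 1 + x / 2 - x ^ 2 / 16 := by
  obtain ⟨h1, h2⟩ := abs_le.1 hx
  have hpos : 0 ≤ 1 + x / 2 - x ^ 2 / 16 := by nlinarith
  rw [Real.sqrt_le_left hpos]
  -- the difference of the two sides is `x² (1/8 - x/16 + x²/256)`
  nlinarith [mul_nonneg (sq_nonneg x) (sub_nonneg.2 h2), mul_nonneg (sq_nonneg x) (sq_nonneg x)]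

theorem abs_mul_re_le_one {b : ℝ} (hb : |b| ≤ 1) {z : ℂ} (hz : ‖z‖ = 1) : |b * z.re| ≤ 1 := by
  rw [abs_mul]
  exact mul_le_one₀ hb (abs_nonneg _) ((Complex.abs_re_le_norm z).trans_eq hz)

theorem rieszProduct_nonneg {b : ℝ} (hb : |b| ≤ 1) (m : ℕ) {z : ℂ} (hz : ‖z‖ = 1) :
    0 ≤ rieszProduct b m z := by
  induction m generalizing z with
  | zero => exact zero_le_one
  | succ m ih =>
    have := (abs_le.1 (abs_mul_re_le_one hb hz)).1
    exact mul_nonneg (by linarith) (ih (by simp [hz]))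

theorem continuous_rieszProduct (b : ℝ) (m : ℕ) : Continuous (rieszProduct b m) := by
  induction m with
  | zero => exact continuous_const
  | succ m ih => exact Continuous.mul (by fun_prop) (ih.comp (continuous_pow 3))

theorem sqrt_rieszProduct_succ_le {b : ℝ} (hb : |b| ≤ 1) (m : ℕ) {z : ℂ} (hz : ‖z‖ = 1) :
    √(rieszProduct b (m + 1) z) ≤ (1 - b ^ 2 / 32) * √(rieszProduct b m (z ^ 3))
      + b / 2 * (z.re * √(rieszProduct b m (z ^ 3)))
      - b ^ 2 / 32 * ((z ^ 2).re * √(rieszProduct b m (z ^ 3))) := by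
  have hsq : (z ^ 2).re = 2 * z.re ^ 2 - 1 := by
    have h := Complex.sq_norm_sub_sq_re z
    rw [hz] at h
    rw [pow_two, Complex.mul_re]
    linarith
  have hb' := abs_mul_re_le_one hb hz
  rw [rieszProduct, Real.sqrt_mul (by linarith [(abs_le.1 hb').1]), hsq]
  refine (mul_le_mul_of_nonneg_right (sqrt_one_add_le hb') (Real.sqrt_nonneg _)).trans_eq ?_
  ring

theorem integral_sqrt_rieszProduct_le {b : ℝ} (hb : |b| ≤ 1) (m : ℕ) :
    ∫ θ : UnitAddCircle, √(rieszProduct b m (fourier 1 θ)) ≤ (1 - b ^ 2 / 32) ^ m := by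
  induction m with
  | zero => simp [rieszProduct, measureReal_def]
  | succ m ih =>
    set g : UnitAddCircle → ℝ := fun θ => √(rieszProduct b m (fourier 1 θ))
    have hgc : Continuous g := by
      have := continuous_rieszProduct b m
      fun_prop
    have hint : ∀ f : UnitAddCircle → ℝ, Continuous f → Integrable f := fun f hf =>
      hf.integrable_of_hasCompactSupport (HasCompactSupport.of_compactSpace _)
    have hb32 : 0 ≤ 1 - b ^ 2 / 32 := by nlinarith [(sq_le_one_iff_abs_le_one b).2 hb]
    have hdil : ∫ θ, g (3 • θ) = ∫ θ, g θ := integral_comp_nsmul three_ne_zero hgc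
    have hpt : ∀ θ : UnitAddCircle, √(rieszProduct b (m + 1) (fourier 1 θ))
        ≤ (1 - b ^ 2 / 32) * g (3 • θ) + b / 2 * ((fourier 1 θ).re * g (3 • θ))
          - b ^ 2 / 32 * ((fourier 2 θ).re * g (3 • θ)) := fun θ => by
      have h := sqrt_rieszProduct_succ_le hb m (norm_fourier_apply 1 θ)
      rwa [← fourier_one_nsmul, ← fourier_natCast_apply] at h
    calc _ ≤ ∫ θ : UnitAddCircle, ((1 - b ^ 2 / 32) * g (3 • θ)
            + b / 2 * ((fourier 1 θ).re * g (3 • θ))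
            - b ^ 2 / 32 * ((fourier 2 θ).re * g (3 • θ))) := by
          have := continuous_rieszProduct b (m + 1)
          exact integral_mono (hint _ (by fun_prop)) (hint _ (by fun_prop)) hpt
      _ = (1 - b ^ 2 / 32) * ∫ θ, g θ := by
          rw [integral_sub (hint _ (by fun_prop)) (hint _ (by fun_prop)),
            integral_add (hint _ (by fun_prop)) (hint _ (by fun_prop)), integral_const_mul,
            integral_const_mul, integral_const_mul, hdil,
            integral_re_fourier_mul_comp_nsmul_eq_zero three_ne_zero (by norm_num) hgc,
            integral_re_fourier_mul_comp_nsmul_eq_zero three_ne_zero (by norm_num) hgc]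
          ring
      _ ≤ (1 - b ^ 2 / 32) * (1 - b ^ 2 / 32) ^ m := by gcongr
      _ = _ := (pow_succ' _ _).symm

theorem volume_real_lt_rieszProduct_le {b : ℝ} (hb : |b| ≤ 1) (m : ℕ) {δ : ℝ} (hδ : 0 < δ) :
    volume.real {θ : UnitAddCircle | δ < rieszProduct b m (fourier 1 θ)}
      ≤ (1 - b ^ 2 / 32) ^ m / √δ := by
  have hcont : Continuous fun θ : UnitAddCircle => √(rieszProduct b m (fourier 1 θ)) := by
    have := continuous_rieszProduct b m
    fun_prop
  rw [le_div_iff₀' (Real.sqrt_pos.2 hδ)]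
  calc _ ≤ √δ * volume.real {θ : UnitAddCircle | √δ ≤ √(rieszProduct b m (fourier 1 θ))} := by
        refine mul_le_mul_of_nonneg_left (measureReal_mono fun θ hθ => ?_) (Real.sqrt_nonneg _)
        exact Real.sqrt_le_sqrt (le_of_lt hθ)
    _ ≤ ∫ θ : UnitAddCircle, √(rieszProduct b m (fourier 1 θ)) :=
        mul_meas_ge_le_integral_of_nonneg (Eventually.of_forall fun θ => Real.sqrt_nonneg _)
          (hcont.integrable_of_hasCompactSupport (HasCompactSupport.of_compactSpace _)) _
    _ ≤ _ := integral_sqrt_rieszProduct_le hb m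

theorem exists_riesz_parameters {q : ℝ} (hq : 2 < q) {η : ℝ} (hη : 0 < η) :
    ∃ (b : ℝ) (m : ℕ), 0 < b ∧ b ≤ 1 ∧ (1 - b ^ 2 / 32) ^ m < η ∧
      (1 + 2 * (b / 2) ^ q) ^ m < 1 + η := by
  obtain ⟨T, hT0, hT⟩ : ∃ T : ℝ, 0 < T ∧ Real.exp (-(T / 32)) < η := by
    have hlim : Tendsto (fun T : ℝ => Real.exp (-(T / 32))) atTop (𝓝 0) :=
      Real.tendsto_exp_neg_atTop_nhds_zero.comp (tendsto_id.atTop_div_const (by norm_num))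
    exact ((eventually_gt_atTop 0).and (hlim.eventually (gt_mem_nhds hη))).exists
  obtain ⟨b, hbsmall, hb0, hb1⟩ : ∃ b : ℝ,
      Real.exp ((T + 1) / 2 * (b / 2) ^ (q - 2)) < 1 + η ∧ 0 < b ∧ b ≤ 1 := by
    have hcont : ContinuousAt (fun b : ℝ => Real.exp ((T + 1) / 2 * (b / 2) ^ (q - 2))) 0 := by
      have : ContinuousAt (fun b : ℝ => (b / 2) ^ (q - 2)) 0 :=
        (continuousAt_id.div_const 2).rpow_const (Or.inr (by linarith))
      fun_prop
    have hlt : ∀ᶠ b in 𝓝 (0 : ℝ), Real.exp ((T + 1) / 2 * (b / 2) ^ (q - 2)) < 1 + η :=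
      hcont.eventually_lt_const (by simp [Real.zero_rpow (by linarith : q - 2 ≠ 0), hη])
    exact ((hlt.filter_mono nhdsWithin_le_nhds).and (Ioc_mem_nhdsGT one_pos)).exists
  have hbsq : 0 < b ^ 2 := by positivity
  have hb32 : 0 ≤ 1 - b ^ 2 / 32 := by nlinarith
  set m := ⌈T / b ^ 2⌉₊
  have hm1 : T ≤ m * b ^ 2 := (div_le_iff₀ hbsq).1 (Nat.le_ceil _)
  have hm2 : m * b ^ 2 ≤ T + 1 := by
    have := mul_le_mul_of_nonneg_right (Nat.ceil_lt_add_one (div_pos hT0 hbsq).le).le hbsq.le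
    rw [add_mul, div_mul_cancel₀ _ hbsq.ne'] at this
    nlinarith
  refine ⟨b, m, hb0, hb1, lt_of_le_of_lt ?_ hT, lt_of_le_of_lt ?_ hbsmall⟩
  · calc (1 - b ^ 2 / 32) ^ m ≤ Real.exp (-(b ^ 2 / 32)) ^ m :=
          pow_le_pow_left₀ hb32 (by linarith [Real.add_one_le_exp (-(b ^ 2 / 32))]) m
      _ ≤ Real.exp (-(T / 32)) := by
          rw [← Real.exp_nat_mul, Real.exp_le_exp]
          linarith
  · have hsplit : (b / 2) ^ q = (b / 2) ^ 2 * (b / 2) ^ (q - 2) := by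
      rw [← Real.rpow_natCast, ← Real.rpow_add (by positivity)]
      norm_num
    calc (1 + 2 * (b / 2) ^ q) ^ m ≤ Real.exp (2 * (b / 2) ^ q) ^ m :=
          pow_le_pow_left₀ (by positivity) (by linarith [Real.add_one_le_exp (2 * (b / 2) ^ q)]) m
      _ = Real.exp (m * b ^ 2 / 2 * (b / 2) ^ (q - 2)) := by
          rw [← Real.exp_nat_mul, hsplit]
          ring_nf
      _ ≤ Real.exp ((T + 1) / 2 * (b / 2) ^ (q - 2)) := by gcongr

end RieszSmallness

section SmallCoefficientPolynomials

open Polynomial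

theorem norm_one_sub_mul_sub_one_le {δ h : ℝ} (hδ : δ ≤ 1) (h0 : 0 ≤ h) (hh : h ≤ δ) {y : ℂ}
    (hy : ‖y - 1‖ ≤ δ) : ‖(1 - h) * y - 1‖ ≤ 3 * δ := by
  have hsplit : (1 - h) * y - 1 = (1 - h) * (y - 1) - h := by ring
  have hnorm : ‖(1 - h : ℂ)‖ = 1 - h := by
    rw [← Complex.ofReal_one, ← Complex.ofReal_sub, Complex.norm_real,
      Real.norm_of_nonneg (by linarith)]
  rw [hsplit]
  refine (norm_sub_le _ _).trans ?_
  rw [norm_mul, hnorm, Complex.norm_real, Real.norm_of_nonneg h0]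
  nlinarith [norm_nonneg (y - 1)]

/-- The analytic polynomial `Q` whose product `z Q(z)` with the variable is
`(1 - h(z)) · z ^ N P(z ^ N)`, where `h` is a Riesz product of degree less than `N`. -/
noncomputable def rieszModification (b : ℝ) (m : ℕ) (P : ℂ[X]) : ℂ[X] :=
  X ^ rieszCenter m * ((X ^ rieszCenter m - rieszPolynomial b m)
    * expand ℂ (2 * rieszCenter m + 1) P)

theorem mul_eval_rieszModification (b : ℝ) (m : ℕ) (P : ℂ[X]) {z : ℂ} (hz : ‖z‖ = 1) :
    z * (rieszModification b m P).eval z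
      = (1 - rieszProduct b m z)
        * (z ^ (2 * rieszCenter m + 1) * P.eval (z ^ (2 * rieszCenter m + 1))) := by
  simp only [rieszModification, eval_mul, eval_sub, eval_pow, eval_X, expand_eval,
    eval_rieszPolynomial b m hz]
  ring

theorem lqSum_rieszModification {b q : ℝ} (hb : 0 ≤ b) (hq : q ≠ 0) (m : ℕ) (P : ℂ[X]) :
    lqSum q (rieszModification b m P) = ((1 + 2 * (b / 2) ^ q) ^ m - 1) * lqSum q P := by
  have hdeg : (X ^ rieszCenter m - rieszPolynomial b m).natDegree < 2 * rieszCenter m + 1 := by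
    refine Nat.lt_succ_of_le ((natDegree_sub_le _ _).trans (max_le ?_ ?_))
    · exact (natDegree_X_pow_le _).trans (by omega)
    · exact natDegree_rieszPolynomial_le b m
  rw [rieszModification, lqSum_X_pow_mul hq, lqSum_mul_expand hq hdeg,
    lqSum_sub_of_coeff_eq_one hq (coeff_rieszPolynomial_rieszCenter b m),
    lqSum_rieszPolynomial hb hq]

theorem setOf_lt_rieszModification_subset {b δ : ℝ} (hb : |b| ≤ 1) (hδ : δ ≤ 1) (m : ℕ)
    (P : ℂ[X]) :
    {θ : UnitAddCircle |
        3 * δ < ‖fourier 1 θ * (rieszModification b m P).eval (fourier 1 θ) - 1‖}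
      ⊆ {θ | δ < rieszProduct b m (fourier 1 θ)}
        ∪ (fun θ => (2 * rieszCenter m + 1) • θ) ⁻¹'
          {θ | δ < ‖fourier 1 θ * P.eval (fourier 1 θ) - 1‖} := by
  intro θ hθ
  by_contra hc
  simp only [Set.mem_union, Set.mem_preimage, Set.mem_ofPred_eq, not_or, not_lt,
    fourier_one_nsmul] at hc
  refine (norm_one_sub_mul_sub_one_le hδ (rieszProduct_nonneg hb m (norm_fourier_apply 1 θ))
    hc.1 hc.2).not_gt ?_
  rwa [← mul_eval_rieszModification b m P (norm_fourier_apply 1 θ)]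

theorem measurableSet_lt_norm_mul_eval_sub_one (P : ℂ[X]) (δ : ℝ) :
    MeasurableSet {θ : UnitAddCircle | δ < ‖fourier 1 θ * P.eval (fourier 1 θ) - 1‖} :=
  (isOpen_lt continuous_const (by fun_prop)).measurableSet

theorem volume_lt_rieszModification_le {b δ : ℝ} (hb : |b| ≤ 1) (hδ : δ ≤ 1) (m : ℕ) (P : ℂ[X]) :
    volume {θ : UnitAddCircle |
        3 * δ < ‖fourier 1 θ * (rieszModification b m P).eval (fourier 1 θ) - 1‖}
      ≤ volume {θ : UnitAddCircle | δ < rieszProduct b m (fourier 1 θ)}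
        + volume {θ : UnitAddCircle | δ < ‖fourier 1 θ * P.eval (fourier 1 θ) - 1‖} := by
  have hdil := (measurePreserving_nsmul_addCircle (T := 1) (K := 2 * rieszCenter m + 1)
    (Nat.succ_ne_zero _)).measure_preimage
      (measurableSet_lt_norm_mul_eval_sub_one P δ).nullMeasurableSet
  rw [← hdil]
  exact (measure_mono (setOf_lt_rieszModification_subset hb hδ m P)).trans (measure_union_le _ _)

theorem exists_lqSum_lt_and_volume_lt {q : ℝ} (hq : 2 < q) {δ : ℝ} (hδ : 0 < δ) :
    ∃ P : ℂ[X], lqSum q P < δ ∧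
      volume {θ : UnitAddCircle | δ < ‖fourier 1 θ * P.eval (fourier 1 θ) - 1‖}
        < ENNReal.ofReal δ := by
  have hq0 : q ≠ 0 := by linarith
  set δ' : ℝ := min δ 1 / 4 with hδ'
  have hδ'0 : 0 < δ' := by positivity
  have hδ'1 : δ' ≤ 1 := by linarith [min_le_right δ 1]
  have hδ'δ : 4 * δ' ≤ δ := by linarith [min_le_left δ 1]
  obtain ⟨P, hP⟩ := exists_volume_norm_mul_eval_sub_one_lt hδ'0
  have hP1 : 0 < lqSum q P + 1 := by linarith [lqSum_nonneg (q := q) P]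
  obtain ⟨b, m, hb0, hb1, hb, hbq⟩ := exists_riesz_parameters hq
    (η := min (δ' * √δ') (δ / (lqSum q P + 1))) (by positivity)
  have hbabs : |b| ≤ 1 := by rwa [abs_of_pos hb0]
  refine ⟨rieszModification b m P, ?_, ?_⟩
  · rw [lqSum_rieszModification hb0.le hq0]
    have hlt : (1 + 2 * (b / 2) ^ q) ^ m - 1 < δ / (lqSum q P + 1) := by
      linarith [min_le_right (δ' * √δ') (δ / (lqSum q P + 1))]
    have hge : 1 ≤ (1 + 2 * (b / 2) ^ q) ^ m :=
      one_le_pow₀ (le_add_of_nonneg_right (by positivity))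
    rw [lt_div_iff₀ hP1] at hlt
    linarith
  · have hriesz : volume {θ : UnitAddCircle | δ' < rieszProduct b m (fourier 1 θ)}
        ≤ ENNReal.ofReal δ' := by
      rw [← ofReal_measureReal]
      refine ENNReal.ofReal_le_ofReal ((volume_real_lt_rieszProduct_le hbabs m hδ'0).trans ?_)
      rw [div_le_iff₀ (Real.sqrt_pos.2 hδ'0)]
      exact hb.le.trans (min_le_left _ _)
    have hsub : {θ : UnitAddCircle |
        δ < ‖fourier 1 θ * (rieszModification b m P).eval (fourier 1 θ) - 1‖}
        ⊆ {θ | 3 * δ' < ‖fourier 1 θ * (rieszModification b m P).eval (fourier 1 θ) - 1‖} :=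
      Set.ofPred_subset_ofPred.2 fun θ hθ => lt_trans (by linarith) hθ
    calc _ ≤ _ := measure_mono hsub
      _ ≤ _ := volume_lt_rieszModification_le hbabs hδ'1 m P
      _ ≤ ENNReal.ofReal δ' + ENNReal.ofReal δ' := add_le_add hriesz hP.le
      _ < ENNReal.ofReal δ := by
          rw [← ENNReal.ofReal_add hδ'0.le hδ'0.le]
          exact (ENNReal.ofReal_lt_ofReal_iff hδ).2 (by linarith)

theorem lqSum_le_lqSum {q r : ℝ} (hr : 0 < r) (hrq : r ≤ q) {P : ℂ[X]} (hP : lqSum r P ≤ 1) :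
    lqSum q P ≤ lqSum r P := by
  refine Finset.sum_le_sum fun i hi => ?_
  have hle : ‖P.coeff i‖ ^ r ≤ 1 :=
    (Finset.single_le_sum (f := fun i => ‖P.coeff i‖ ^ r) (fun _ _ => by positivity) hi).trans hP
  have hnorm : ‖P.coeff i‖ ≤ 1 := by
    by_contra! h
    exact (Real.one_lt_rpow h hr).not_ge hle
  exact Real.rpow_le_rpow_of_exponent_ge (norm_pos_iff.2 (mem_support_iff.1 hi)) hnorm hrq

theorem exists_seq_lqSum_tendsto_zero :
    ∃ P : ℕ → ℂ[X], (∀ q : ℝ, 2 < q → Tendsto (fun k => lqSum q (P k)) atTop (𝓝 0)) ∧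
      ∀ k, volume {θ : UnitAddCircle |
          (1 / 2 : ℝ) ^ k < ‖fourier 1 θ * (P k).eval (fourier 1 θ) - 1‖}
        < ENNReal.ofReal ((1 / 2) ^ k) := by
  have hr : ∀ k : ℕ, 2 < 2 + 1 / ((k : ℝ) + 1) := fun k =>
    lt_add_of_pos_right _ Nat.one_div_pos_of_nat
  choose P hPq hPvol using fun k : ℕ =>
    exists_lqSum_lt_and_volume_lt (hr k) (δ := (1 / 2 : ℝ) ^ k) (by positivity)
  refine ⟨P, fun q hq => ?_, hPvol⟩
  have hlim : Tendsto (fun k : ℕ => 2 + 1 / ((k : ℝ) + 1)) atTop (𝓝 (2 + 0)) :=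
    tendsto_one_div_add_atTop_nhds_zero_nat.const_add 2
  refine tendsto_of_tendsto_of_tendsto_of_le_of_le' tendsto_const_nhds
    (tendsto_pow_atTop_nhds_zero_of_lt_one one_half_pos.le one_half_lt_one)
    (Eventually.of_forall fun k => lqSum_nonneg _) ?_
  filter_upwards [hlim.eventually_lt_const (by simpa using hq)] with k hk
  have hone : lqSum (2 + 1 / ((k : ℝ) + 1)) (P k) ≤ 1 :=
    (hPq k).le.trans (pow_le_one₀ one_half_pos.le one_half_lt_one.le)
  exact (lqSum_le_lqSum (by linarith [hr k]) hk.le hone).trans (hPq k).le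

end SmallCoefficientPolynomials

section Bessel

variable {𝕜 ι H : Type*} [RCLike 𝕜] [NormedAddCommGroup H] [InnerProductSpace 𝕜 H]

theorem sum_mul_mul_le_of_row_sum_le {F : Finset ι} {g : ι → ι → ℝ} {B : ℝ}
    (hg : ∀ m n, 0 ≤ g m n) (hsymm : ∀ m n, g m n = g n m) (hB : ∀ m, ∑ n ∈ F, g m n ≤ B)
    (a : ι → ℝ) : ∑ m ∈ F, ∑ n ∈ F, a m * a n * g m n ≤ B * ∑ n ∈ F, a n ^ 2 := by
  have hswap : ∑ m ∈ F, ∑ n ∈ F, a n ^ 2 * g m n = ∑ m ∈ F, ∑ n ∈ F, a m ^ 2 * g m n := by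
    rw [Finset.sum_comm]
    simp only [hsymm]
  calc ∑ m ∈ F, ∑ n ∈ F, a m * a n * g m n
      ≤ ∑ m ∈ F, ∑ n ∈ F, (1 / 2 * (a m ^ 2 * g m n) + 1 / 2 * (a n ^ 2 * g m n)) := by
        gcongr with m _ n _
        nlinarith [mul_nonneg (sq_nonneg (a m - a n)) (hg m n)]
    _ = ∑ m ∈ F, a m ^ 2 * ∑ n ∈ F, g m n := by
        simp only [Finset.sum_add_distrib, ← Finset.mul_sum, hswap]
        ring
    _ ≤ ∑ m ∈ F, a m ^ 2 * B := by
        gcongr with m _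
        exact hB m
    _ = B * ∑ n ∈ F, a n ^ 2 := by rw [← Finset.sum_mul, mul_comm]

theorem norm_sum_smul_sq_le_of_gram {u : ι → H} {F : Finset ι} {B : ℝ}
    (hB : ∀ m, ∑ n ∈ F, ‖inner 𝕜 (u m) (u n)‖ ≤ B) (c : ι → 𝕜) :
    ‖∑ n ∈ F, c n • u n‖ ^ 2 ≤ B * ∑ n ∈ F, ‖c n‖ ^ 2 := by
  calc ‖∑ n ∈ F, c n • u n‖ ^ 2
      = ‖inner 𝕜 (∑ m ∈ F, c m • u m) (∑ n ∈ F, c n • u n)‖ := by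
        rw [inner_self_eq_norm_sq_to_K, norm_pow, RCLike.norm_ofReal, abs_norm]
    _ ≤ ∑ m ∈ F, ∑ n ∈ F, ‖c m‖ * ‖c n‖ * ‖inner 𝕜 (u m) (u n)‖ := by
        rw [sum_inner]
        refine norm_sum_le_of_le _ fun m _ => ?_
        rw [inner_sum]
        refine norm_sum_le_of_le _ fun n _ => ?_
        rw [inner_smul_left, inner_smul_right, norm_mul, norm_mul, RCLike.norm_conj, mul_assoc]
    _ ≤ B * ∑ n ∈ F, ‖c n‖ ^ 2 :=
        sum_mul_mul_le_of_row_sum_le (fun _ _ => norm_nonneg _)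
          (fun m n => norm_inner_symm (u m) (u n)) hB fun n => ‖c n‖

theorem sum_norm_inner_sq_le {u : ι → H} {F : Finset ι} {B : ℝ} (hB0 : 0 ≤ B)
    (hB : ∀ c : ι → 𝕜, ‖∑ n ∈ F, c n • u n‖ ^ 2 ≤ B * ∑ n ∈ F, ‖c n‖ ^ 2) (f : H) :
    ∑ n ∈ F, ‖inner 𝕜 f (u n)‖ ^ 2 ≤ B * ‖f‖ ^ 2 := by
  set S := ∑ n ∈ F, ‖inner 𝕜 f (u n)‖ ^ 2 with hS
  set g : H := ∑ n ∈ F, (starRingEnd 𝕜) (inner 𝕜 f (u n)) • u n with hg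
  have hS0 : 0 ≤ S := Finset.sum_nonneg fun _ _ => by positivity
  have hgS : ‖g‖ ^ 2 ≤ B * S := (hB _).trans_eq (by simp only [RCLike.norm_conj, hS])
  have hinner : inner 𝕜 f g = (S : 𝕜) := by
    simp only [hg, hS, inner_sum, inner_smul_right, RCLike.conj_mul]
    push_cast
    rfl
  have hSfg : S ≤ ‖f‖ * ‖g‖ := by
    have h := norm_inner_le_norm (𝕜 := 𝕜) f g
    rwa [hinner, RCLike.norm_ofReal, abs_of_nonneg hS0] at h
  have hsq : S * S ≤ B * ‖f‖ ^ 2 * S := by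
    calc S * S ≤ (‖f‖ * ‖g‖) * (‖f‖ * ‖g‖) := by gcongr
      _ = ‖f‖ ^ 2 * ‖g‖ ^ 2 := by ring
      _ ≤ ‖f‖ ^ 2 * (B * S) := by gcongr
      _ = B * ‖f‖ ^ 2 * S := by ring
  rcases hS0.eq_or_lt with h0 | hpos
  · rw [← h0]
    positivity
  · exact le_of_mul_le_mul_right hsq hpos

theorem bessel_of_norm_sum_smul_sq_le {u : ι → H} {B : ℝ} (hB0 : 0 ≤ B)
    (hB : ∀ (F : Finset ι) (c : ι → 𝕜), ‖∑ n ∈ F, c n • u n‖ ^ 2 ≤ B * ∑ n ∈ F, ‖c n‖ ^ 2)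
    (f : H) :
    Summable (fun n => ‖inner 𝕜 f (u n)‖ ^ 2) ∧
      √(∑' n, ‖inner 𝕜 f (u n)‖ ^ 2) ≤ √B * ‖f‖ := by
  have hfin (F : Finset ι) : ∑ n ∈ F, ‖inner 𝕜 f (u n)‖ ^ 2 ≤ B * ‖f‖ ^ 2 :=
    sum_norm_inner_sq_le hB0 (hB F) f
  have hsum : Summable fun n => ‖inner 𝕜 f (u n)‖ ^ 2 :=
    summable_of_sum_le (fun _ => by positivity) hfin
  refine ⟨hsum, ?_⟩
  rw [Real.sqrt_le_left (by positivity), mul_pow, Real.sq_sqrt hB0]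
  exact hsum.tsum_le_of_sum_le hfin

end Bessel

section Exponentials

variable {w : ℝ → ℝ}

theorem isWeight_gaussian : IsWeight fun x : ℝ => Real.exp (-x ^ 2) where
  integrable := by simpa using integrable_exp_neg_mul_sq one_pos
  pos := Eventually.of_forall fun x => Real.exp_pos _

theorem coeFn_expL2 (hw : IsWeight w) (l : ℝ) :
    expL2 hw l =ᵐ[weightMeasure w] fun x : ℝ => Complex.exp (Complex.I * l * x) :=
  MemLp.coeFn_toLp _

theorem coeFn_sum_expL2 {ι : Type*} (hw : IsWeight w) (F : Finset ι) (c : ι → ℂ) (l : ι → ℝ) :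
    (∑ n ∈ F, c n • expL2 hw (l n) : WeightedL2 w)
      =ᵐ[weightMeasure w] fun x : ℝ => ∑ n ∈ F, c n * Complex.exp (Complex.I * l n * x) := by
  have hterm : ∀ n ∈ F, (c n • expL2 hw (l n) : WeightedL2 w)
      =ᵐ[weightMeasure w] fun x : ℝ => c n * Complex.exp (Complex.I * l n * x) := by
    intro n _
    filter_upwards [Lp.coeFn_smul (c n) (expL2 hw (l n)), coeFn_expL2 hw (l n)] with x hsmul hexp
    rw [hsmul, Pi.smul_apply, hexp, smul_eq_mul]
  filter_upwards [Lp.coeFn_finsetSum F fun n => (c n • expL2 hw (l n) : WeightedL2 w),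
    (ae_ball_iff F.countable_toSet).2 hterm] with x hsum hx
  rw [hsum, Finset.sum_apply]
  exact Finset.sum_congr rfl hx

theorem norm_sum_expL2_mono {ι : Type*} {w' : ℝ → ℝ} (hw : IsWeight w) (hw' : IsWeight w')
    (hle : w ≤ᵐ[volume] w') (F : Finset ι) (c : ι → ℂ) (l : ι → ℝ) :
    ‖∑ n ∈ F, c n • expL2 hw (l n)‖ ≤ ‖∑ n ∈ F, c n • expL2 hw' (l n)‖ := by
  rw [Lp.norm_def, Lp.norm_def]
  refine ENNReal.toReal_mono (Lp.eLpNorm_ne_top _) ?_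
  rw [eLpNorm_congr_ae (coeFn_sum_expL2 hw F c l), eLpNorm_congr_ae (coeFn_sum_expL2 hw' F c l)]
  exact eLpNorm_mono_measure _ (withDensity_mono (hle.mono fun x => ENNReal.ofReal_le_ofReal))

theorem inner_expL2_expL2 (hw : IsWeight w) (a b : ℝ) :
    inner ℂ (expL2 hw a) (expL2 hw b)
      = ∫ x : ℝ, (ENNReal.ofReal (w x)).toReal •
          Complex.exp (Complex.I * ((b - a : ℝ) : ℂ) * x) := by
  rw [L2.inner_def, ← integral_withDensity_eq_integral_toReal_smul₀
    hw.integrable.1.aemeasurable.ennreal_ofReal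
    (Eventually.of_forall fun x => ENNReal.ofReal_lt_top), ← weightMeasure]
  refine integral_congr_ae ?_
  filter_upwards [coeFn_expL2 hw a, coeFn_expL2 hw b] with x ha hb
  rw [ha, hb, RCLike.inner_apply, ← Complex.exp_conj, ← Complex.exp_add]
  simp only [map_mul, Complex.conj_I, Complex.conj_ofReal]
  push_cast
  congr 1
  ring

theorem norm_inner_expL2_gaussian (a b : ℝ) :
    ‖inner ℂ (expL2 isWeight_gaussian a) (expL2 isWeight_gaussian b)‖
      = √Real.pi * Real.exp (-(a - b) ^ 2 / 4) := by
  have hfourier : inner ℂ (expL2 isWeight_gaussian a) (expL2 isWeight_gaussian b)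
      = ∫ x : ℝ, Complex.exp (Complex.I * ((b - a : ℝ) : ℂ) * x) *
          Complex.exp (-1 * (x : ℂ) ^ 2) := by
    rw [inner_expL2_expL2]
    refine integral_congr_ae (Eventually.of_forall fun x => ?_)
    simp only [ENNReal.toReal_ofReal (Real.exp_pos _).le, Complex.real_smul]
    push_cast
    rw [mul_comm, neg_one_mul]
  rw [hfourier, fourierIntegral_gaussian (by simp), norm_mul, Complex.norm_exp]
  congr 1
  · rw [div_one, show (1 / 2 : ℂ) = ((1 / 2 : ℝ) : ℂ) by push_cast; rfl,
      ← Complex.ofReal_cpow Real.pi_pos.le, Complex.norm_real, Real.sqrt_eq_rpow,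
      Real.norm_of_nonneg (by positivity)]
  · congr 1
    rw [show (-((b - a : ℝ) : ℂ) ^ 2 / (4 * 1)) = ((-(a - b) ^ 2 / 4 : ℝ) : ℂ) by push_cast; ring,
      Complex.ofReal_re]

theorem exp_neg_sq_div_four_le {δ : ℝ} (hδ : 0 < δ) (x : ℝ) :
    Real.exp (-x ^ 2 / 4) ≤ Real.exp (1 + δ) * Real.exp (-δ) ^ ⌊x / δ⌋.natAbs := by
  rw [← Real.exp_nat_mul, ← Real.exp_add, Real.exp_le_exp, Nat.cast_natAbs, Int.cast_abs]
  have hfloor : |(⌊x / δ⌋ : ℝ)| ≤ |x / δ| + 1 := by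
    have hfract : |Int.fract (x / δ)| ≤ 1 := by
      rw [Int.abs_fract]
      exact (Int.fract_lt_one _).le
    have htri := abs_sub (x / δ) (Int.fract (x / δ))
    rw [Int.self_sub_fract] at htri
    linarith
  have hmul : δ * |(⌊x / δ⌋ : ℝ)| ≤ |x| + δ := by
    rw [abs_div, abs_of_pos hδ] at hfloor
    calc δ * |(⌊x / δ⌋ : ℝ)| ≤ δ * (|x| / δ + 1) := by gcongr
      _ = |x| + δ := by field_simp
  nlinarith [sq_nonneg (|x| - 2), sq_abs x]

theorem exists_sum_exp_neg_sq_sub_le {ι : Type*} {lam : ι → ℝ} {δ : ℝ} (hδ : 0 < δ)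
    (hsep : Pairwise fun m n => δ ≤ |lam m - lam n|) :
    ∃ B : ℝ, ∀ (F : Finset ι) (x : ℝ), ∑ n ∈ F, Real.exp (-(x - lam n) ^ 2 / 4) ≤ B := by
  set b : ℤ → ℝ := fun k => Real.exp (1 + δ) * Real.exp (-δ) ^ k.natAbs
  have hsum : Summable b := by
    have hgeom : Summable fun k : ℕ => Real.exp (-δ) ^ k :=
      summable_geometric_of_lt_one (Real.exp_pos _).le (by simpa)
    refine Summable.mul_left _ (Summable.of_nat_of_neg ?_ ?_) <;> simpa using hgeom
  refine ⟨∑' k, b k, fun F x => ?_⟩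
  have hinj : Function.Injective fun n => ⌊(x - lam n) / δ⌋ := by
    refine fun m n hmn => by_contra fun hne => ?_
    have hlt := Int.abs_sub_lt_one_of_floor_eq_floor hmn
    rw [← sub_div, abs_div, abs_of_pos hδ, div_lt_one hδ, sub_sub_sub_cancel_left] at hlt
    exact hlt.not_ge (hsep (Ne.symm hne))
  calc ∑ n ∈ F, Real.exp (-(x - lam n) ^ 2 / 4)
      ≤ ∑ n ∈ F, b ⌊(x - lam n) / δ⌋ :=
        Finset.sum_le_sum fun n _ => exp_neg_sq_div_four_le hδ _
    _ = ∑ k ∈ F.image fun n => ⌊(x - lam n) / δ⌋, b k := (Finset.sum_image hinj.injOn).symm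
    _ ≤ ∑' k, b k := hsum.sum_le_tsum _ fun _ _ => by positivity

theorem exists_bessel_bound {ι : Type*} (hw : IsWeight w)
    (hle : w ≤ᵐ[volume] fun x => Real.exp (-x ^ 2)) {lam : ι → ℝ} {δ : ℝ} (hδ : 0 < δ)
    (hsep : Pairwise fun m n => δ ≤ |lam m - lam n|) :
    ∃ C : ℝ, ∀ f : WeightedL2 w, Summable (fun n => ‖inner ℂ f (expL2 hw (lam n))‖ ^ 2) ∧
      √(∑' n, ‖inner ℂ f (expL2 hw (lam n))‖ ^ 2) ≤ C * ‖f‖ := by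
  obtain ⟨B, hB⟩ := exists_sum_exp_neg_sq_sub_le hδ hsep
  have hB0 : 0 ≤ B := by simpa using hB ∅ 0
  refine ⟨√(√Real.pi * B), bessel_of_norm_sum_smul_sq_le (by positivity) fun F c => ?_⟩
  calc ‖∑ n ∈ F, c n • expL2 hw (lam n)‖ ^ 2
      ≤ ‖∑ n ∈ F, c n • expL2 isWeight_gaussian (lam n)‖ ^ 2 := by
        gcongr
        exact norm_sum_expL2_mono hw isWeight_gaussian hle F c lam
    _ ≤ √Real.pi * B * ∑ n ∈ F, ‖c n‖ ^ 2 := by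
        refine norm_sum_smul_sq_le_of_gram (fun m => ?_) c
        simp only [norm_inner_expL2_gaussian, ← Finset.mul_sum]
        gcongr
        exact hB F _

end Exponentials

section Density

open FourierTransform SchwartzMap

theorem ae_eq_zero_of_fourier_eq_zero {V E : Type*} [NormedAddCommGroup V] [InnerProductSpace ℝ V]
    [FiniteDimensional ℝ V] [MeasurableSpace V] [BorelSpace V] [NormedAddCommGroup E]
    [NormedSpace ℂ E] [CompleteSpace E] {g : V → E} (hg : Integrable g) (hzero : 𝓕 g = 0) :
    g =ᵐ[volume] 0 := by
  refine ae_eq_zero_of_integral_contDiff_smul_eq_zero hg.locallyIntegrable fun ψ hψ hψc => ?_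
  have hsupp : HasCompactSupport (Complex.ofRealCLM ∘ ψ) := hψc.comp_left rfl
  set Ψ : 𝓢(V, ℂ) := hsupp.toSchwartzMap (by fun_prop)
  have hΨ : 𝓕 ((𝓕⁻ Ψ : 𝓢(V, ℂ)) : V → ℂ) = Ψ := by
    rw [← fourier_coe, FourierTransform.fourier_fourierInv_eq]
  have hself := VectorFourier.integral_fourierIntegral_smul_eq_flip (L := innerₗ V)
    Real.continuous_fourierChar continuous_inner
    ((𝓕⁻ Ψ : 𝓢(V, ℂ)).integrable (μ := volume)) hg
  rw [flip_innerₗ] at hself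
  calc ∫ x, ψ x • g x = ∫ x, 𝓕 ((𝓕⁻ Ψ : 𝓢(V, ℂ)) : V → ℂ) x • g x := by
        rw [hΨ]
        rfl
    _ = ∫ x, (𝓕⁻ Ψ : 𝓢(V, ℂ)) x • 𝓕 g x := hself
    _ = 0 := by simp [hzero]

variable {w : ℝ → ℝ}

theorem inner_expL2_eq_fourier (hw : IsWeight w) (f : WeightedL2 w) (t : ℝ) :
    inner ℂ (expL2 hw (2 * Real.pi * t)) f
      = 𝓕 (fun x : ℝ => (ENNReal.ofReal (w x)).toReal • f x) t := by
  rw [L2.inner_def, Real.fourier_real_eq_integral_exp_smul]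
  calc ∫ x, inner ℂ (expL2 hw (2 * Real.pi * t) x) (f x) ∂weightMeasure w
      = ∫ x, Complex.exp (((-2 * Real.pi * x * t : ℝ) : ℂ) * Complex.I) • f x
          ∂weightMeasure w := by
        refine integral_congr_ae ?_
        filter_upwards [coeFn_expL2 hw (2 * Real.pi * t)] with x hx
        rw [hx, RCLike.inner_apply, ← Complex.exp_conj, mul_comm, smul_eq_mul]
        simp only [map_mul, Complex.conj_I, Complex.conj_ofReal]
        push_cast
        congr 2
        ring
    _ = ∫ x, (ENNReal.ofReal (w x)).toReal •
          Complex.exp (((-2 * Real.pi * x * t : ℝ) : ℂ) * Complex.I) • f x :=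
        integral_withDensity_eq_integral_toReal_smul₀
          hw.integrable.1.aemeasurable.ennreal_ofReal
          (Eventually.of_forall fun x => ENNReal.ofReal_lt_top) _
    _ = ∫ x : ℝ, Complex.exp (((-2 * Real.pi * x * t : ℝ) : ℂ) * Complex.I) •
          (ENNReal.ofReal (w x)).toReal • f x := by
        simp_rw [smul_comm (ENNReal.toReal _)]

theorem span_expL2_topologicalClosure_eq_top {ι : Type*} (hw : IsWeight w) {σ : ι → ℝ}
    (hσ : DenseRange σ) :
    (Submodule.span ℂ (Set.range fun i => expL2 hw (2 * Real.pi * σ i))).topologicalClosure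
      = ⊤ := by
  have := hw.isFiniteMeasure
  rw [Submodule.topologicalClosure_eq_top_iff, Submodule.eq_bot_iff]
  intro f hf
  set g : ℝ → ℂ := fun x => (ENNReal.ofReal (w x)).toReal • f x with hg
  have hgi : Integrable g := by
    rw [hg, ← integrable_withDensity_iff_integrable_smul₀'
      hw.integrable.1.aemeasurable.ennreal_ofReal
      (Eventually.of_forall fun x => ENNReal.ofReal_lt_top)]
    exact (Lp.memLp f).integrable one_le_two
  have hcont : Continuous (𝓕 g) :=
    VectorFourier.fourierIntegral_continuous (L := innerₗ ℝ) Real.continuous_fourierChar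
      continuous_inner hgi
  have hfourier : 𝓕 g = 0 := by
    refine hσ.equalizer hcont continuous_const (funext fun i => ?_)
    rw [Function.comp_apply, ← inner_expL2_eq_fourier hw f]
    exact (Submodule.mem_orthogonal _ _).1 hf _ (Submodule.subset_span ⟨i, rfl⟩)
  rw [Lp.eq_zero_iff_ae_eq_zero]
  refine (withDensity_absolutelyContinuous volume _).ae_le ?_
  filter_upwards [ae_eq_zero_of_fourier_eq_zero hgi hfourier, hw.pos] with x hx hwx
  have hwf : w x • f x = 0 := by
    simpa only [hg, ENNReal.toReal_ofReal hwx.le, Pi.zero_apply] using hx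
  exact (smul_eq_zero.1 hwf).resolve_left hwx.ne'

end Density

section Weights

theorem ae_of_ae_unitAddCircle {p : UnitAddCircle → Prop} (h : ∀ᵐ θ, p θ) :
    ∀ᵐ x : ℝ, p (x : UnitAddCircle) := by
  have hIoc (n : ℤ) :
      ∀ᵐ x : ℝ ∂volume.restrict (Set.Ioc (n : ℝ) (n + 1)), p (x : UnitAddCircle) :=
    (UnitAddCircle.measurePreserving_mk (n : ℝ)).quasiMeasurePreserving.ae h
  rwa [← ae_restrict_iUnion_iff, iUnion_Ioc_intCast, Measure.restrict_univ] at hIoc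

theorem ae_eventually_nsmul_notMem {S : ℕ → Set UnitAddCircle} (hS : ∀ k, MeasurableSet (S k))
    (hsum : ∑' k, volume (S k) ≠ ⊤) {L : ℕ → ℕ} (hL : ∀ k, L k ≠ 0) :
    ∀ᵐ x : ℝ, ∀ᶠ k in atTop, L k • (x : UnitAddCircle) ∉ S k := by
  refine ae_of_ae_unitAddCircle (ae_eventually_notMem (s := fun k => {θ | L k • θ ∈ S k}) ?_)
  have hpre (k : ℕ) : volume {θ : UnitAddCircle | L k • θ ∈ S k} = volume (S k) :=
    (measurePreserving_nsmul_addCircle (T := 1) (hL k)).measure_preimage (hS k).nullMeasurableSet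
  simpa only [hpre] using hsum

theorem exists_isWeight_mul_le {ι : Type*} [Countable ι] {g : ℝ → ℝ} (hg : IsWeight g)
    {G : ι → ℝ → ℝ} (hG : ∀ k, Measurable (G k))
    (hbdd : ∀ᵐ x, BddAbove (Set.range fun k => G k x)) :
    ∃ w, IsWeight w ∧ w ≤ᵐ[volume] g ∧ ∀ᵐ x, ∀ k, w x * G k x ≤ g x := by
  set v : ℝ → ENNReal := fun x => 1 ⊔ ⨆ k, ENNReal.ofReal (G k x)
  have hvm : Measurable v := measurable_const.sup (.iSup fun k => (hG k).ennreal_ofReal)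
  have hvtop : ∀ᵐ x, v x ≠ ⊤ := by
    filter_upwards [hbdd] with x ⟨b, hb⟩
    refine (max_lt ENNReal.one_lt_top ((iSup_le fun k => ?_).trans_lt
      (ENNReal.ofReal_lt_top (r := b)))).ne
    exact ENNReal.ofReal_le_ofReal (hb ⟨k, rfl⟩)
  have hv1 {x : ℝ} (hx : v x ≠ ⊤) : 1 ≤ (v x).toReal := by
    simpa using ENNReal.toReal_mono hx (le_max_left _ _)
  have hvG {x : ℝ} (hx : v x ≠ ⊤) (k : ι) : G k x ≤ (v x).toReal :=
    (ENNReal.ofReal_le_iff_le_toReal hx).1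
      ((le_iSup (fun k => ENNReal.ofReal (G k x)) k).trans (le_max_right _ _))
  have hle : (fun x => g x / (v x).toReal) ≤ᵐ[volume] g := by
    filter_upwards [hvtop, hg.pos] with x hx hgx using div_le_self hgx.le (hv1 hx)
  have hpos : ∀ᵐ x, 0 < g x / (v x).toReal := by
    filter_upwards [hvtop, hg.pos] with x hx hgx
    exact div_pos hgx (one_pos.trans_le (hv1 hx))
  refine ⟨fun x => g x / (v x).toReal, ⟨hg.integrable.mono' ?_ ?_, hpos⟩, hle, ?_⟩
  · exact hg.integrable.1.div₀ hvm.ennreal_toReal.aestronglyMeasurable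
  · filter_upwards [hle, hpos] with x hx hx0
    rwa [Real.norm_of_nonneg hx0.le]
  · filter_upwards [hvtop, hg.pos] with x hx hgx k
    rw [div_mul_eq_mul_div, div_le_iff₀ (one_pos.trans_le (hv1 hx))]
    exact mul_le_mul_of_nonneg_left (hvG hx k) hgx.le

variable {w : ℝ → ℝ}

theorem IsWeight.ae_of_ae_weightMeasure (hw : IsWeight w) {p : ℝ → Prop}
    (h : ∀ᵐ x ∂weightMeasure w, p x) : ∀ᵐ x, p x := by
  have hac : volume ≪ weightMeasure w :=
    withDensity_absolutelyContinuous' hw.integrable.1.aemeasurable.ennreal_ofReal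
      (hw.pos.mono fun x hx => by simpa using hx)
  exact hac.ae_le h

theorem norm_sq_eq_integral (hw : IsWeight w) (f : WeightedL2 w) :
    ‖f‖ ^ 2 = ∫ x, w x * ‖f x‖ ^ 2 := by
  have hinner : ((‖f‖ ^ 2 : ℝ) : ℂ) = ((∫ x, ‖f x‖ ^ 2 ∂weightMeasure w : ℝ) : ℂ) := by
    have h := inner_self_eq_norm_sq_to_K (𝕜 := ℂ) f
    rw [L2.inner_def] at h
    rw [← integral_complex_ofReal]
    push_cast
    simpa only [inner_self_eq_norm_sq_to_K] using! h.symm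
  calc ‖f‖ ^ 2 = ∫ x, ‖f x‖ ^ 2 ∂weightMeasure w := Complex.ofReal_inj.1 hinner
    _ = ∫ x, (ENNReal.ofReal (w x)).toReal • ‖f x‖ ^ 2 :=
        integral_withDensity_eq_integral_toReal_smul₀
          hw.integrable.1.aemeasurable.ennreal_ofReal
          (Eventually.of_forall fun x => ENNReal.ofReal_lt_top) _
    _ = ∫ x, w x * ‖f x‖ ^ 2 := by
        refine integral_congr_ae ?_
        filter_upwards [hw.pos] with x hx
        rw [ENNReal.toReal_ofReal hx.le, smul_eq_mul]

end Weights

section Blocks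

open Polynomial

variable {w : ℝ → ℝ}

theorem exp_mul_fourier_pow (s : ℝ) (L j : ℕ) (x : ℝ) :
    Complex.exp (Complex.I * ((2 * Real.pi * (s + L * j) : ℝ) : ℂ) * x)
      = Complex.exp (Complex.I * ((2 * Real.pi * s : ℝ) : ℂ) * x)
        * fourier 1 (L • (x : UnitAddCircle)) ^ j := by
  rw [fourier_one_nsmul, ← pow_mul, fourier_coe_apply, ← Complex.exp_nat_mul, ← Complex.exp_add]
  congr 1
  push_cast
  ring

theorem coeFn_expL2_sub_sum (hw : IsWeight w) (P : ℂ[X]) (s : ℝ) (L : ℕ) :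
    (expL2 hw (2 * Real.pi * s) - P.sum fun j a =>
        a • expL2 hw (2 * Real.pi * (s + L * ((j + 1 : ℕ) : ℝ))) : WeightedL2 w)
      =ᵐ[weightMeasure w] fun x : ℝ =>
        Complex.exp (Complex.I * ((2 * Real.pi * s : ℝ) : ℂ) * x) *
          (1 - fourier 1 (L • (x : UnitAddCircle)) *
            P.eval (fourier 1 (L • (x : UnitAddCircle)))) := by
  rw [Polynomial.sum]
  filter_upwards [Lp.coeFn_sub (expL2 hw (2 * Real.pi * s)) _, coeFn_expL2 hw (2 * Real.pi * s),
    coeFn_sum_expL2 hw P.support P.coeff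
      fun j => 2 * Real.pi * (s + L * ((j + 1 : ℕ) : ℝ))] with x hsub hexp hsum
  rw [hsub, Pi.sub_apply, hexp, hsum, eval_eq_sum, Polynomial.sum, mul_sub, mul_one,
    Finset.mul_sum, Finset.mul_sum]
  congr 1
  refine Finset.sum_congr rfl fun j _ => ?_
  rw [exp_mul_fourier_pow]
  ring

theorem norm_expL2_sub_sum_sq_le (hw : IsWeight w) {P : ℂ[X]} {L : ℕ} {h : ℝ → ℝ}
    (hh : Integrable h)
    (hle : ∀ᵐ x : ℝ, w x * ‖fourier 1 (L • (x : UnitAddCircle)) *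
      P.eval (fourier 1 (L • (x : UnitAddCircle))) - 1‖ ^ 2 ≤ h x) (s : ℝ) :
    ‖expL2 hw (2 * Real.pi * s) - P.sum fun j a =>
        a • expL2 hw (2 * Real.pi * (s + L * ((j + 1 : ℕ) : ℝ)))‖ ^ 2 ≤ ∫ x, h x := by
  rw [norm_sq_eq_integral hw]
  refine integral_mono_of_nonneg (hw.pos.mono fun x hx => by positivity) hh ?_
  filter_upwards [hw.ae_of_ae_weightMeasure (coeFn_expL2_sub_sum hw P s L), hle] with x hx hxle
  have hexp : ‖Complex.exp (Complex.I * ((2 * Real.pi * s : ℝ) : ℂ) * x)‖ = 1 := by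
    rw [Complex.norm_exp]
    simp
  rwa [hx, norm_mul, hexp, one_mul, norm_sub_rev]

theorem exists_isWeight_norm_sq_le {P : ℕ → ℂ[X]} {δ : ℕ → ℝ} (hδ : ∀ k, 0 < δ k)
    (hsum : ∑' k, volume {θ : UnitAddCircle |
      δ k < ‖fourier 1 θ * (P k).eval (fourier 1 θ) - 1‖} ≠ ⊤)
    {L : ℕ → ℕ} (hL : ∀ k, L k ≠ 0) {g : ℝ → ℝ} (hg : IsWeight g) :
    ∃ (w : ℝ → ℝ) (hw : IsWeight w), w ≤ᵐ[volume] g ∧ ∀ (k : ℕ) (s : ℝ),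
      ‖expL2 hw (2 * Real.pi * s) - (P k).sum fun j a =>
          a • expL2 hw (2 * Real.pi * (s + L k * ((j + 1 : ℕ) : ℝ)))‖ ^ 2
        ≤ δ k ^ 2 * ∫ x, g x := by
  set e : ℕ → ℝ → ℝ := fun k x => ‖fourier 1 (L k • (x : UnitAddCircle)) *
    (P k).eval (fourier 1 (L k • (x : UnitAddCircle))) - 1‖
  have hmeas (k : ℕ) : Measurable fun x => (e k x / δ k) ^ 2 := by
    have hcont : Continuous fun θ : UnitAddCircle =>
        ‖fourier 1 θ * (P k).eval (fourier 1 θ) - 1‖ := by fun_prop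
    have hnsmul : Measurable fun x : ℝ => L k • (x : UnitAddCircle) :=
      (measurePreserving_nsmul_addCircle (hL k)).measurable.comp AddCircle.measurable_mk'
    exact ((hcont.measurable.comp hnsmul).div_const _).pow_const 2
  have hbdd : ∀ᵐ x, BddAbove (Set.range fun k => (e k x / δ k) ^ 2) := by
    filter_upwards [ae_eventually_nsmul_notMem
      (fun k => measurableSet_lt_norm_mul_eval_sub_one (P k) (δ k)) hsum hL] with x hx
    refine IsBoundedUnder.bddAbove_range ⟨1, eventually_map.2 (hx.mono fun k hk => ?_)⟩
    have hδk := hδ k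
    exact pow_le_one₀ (by positivity) ((div_le_one₀ hδk).2 (not_lt.1 hk))
  obtain ⟨w, hw, hwg, hwe⟩ := exists_isWeight_mul_le hg hmeas hbdd
  refine ⟨w, hw, hwg, fun k s => ?_⟩
  rw [← integral_const_mul]
  refine norm_expL2_sub_sum_sq_le hw (hg.integrable.const_mul _) (hwe.mono fun x hx => ?_) s
  have hδk := hδ k
  calc w x * e k x ^ 2 = δ k ^ 2 * (w x * (e k x / δ k) ^ 2) := by field_simp
    _ ≤ δ k ^ 2 * g x := by
      gcongr
      exact hx k

end Blocks

section Frequencies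

theorem exists_strictMono_add_le {p : ℕ → ℕ → Prop} (hp : ∀ k, ∀ᶠ n in atTop, p k n)
    (M : ℕ → ℕ) :
    ∃ N : ℕ → ℕ, StrictMono N ∧ (∀ k, N k + M k ≤ N (k + 1)) ∧ ∀ k n, N k ≤ n → p k n := by
  obtain ⟨φ, hφ, hφp⟩ :=
    extraction_forall_of_eventually fun k => eventually_forall_ge_atTop.2 (hp k)
  refine ⟨fun k => φ k + ∑ i ∈ Finset.range k, M i, hφ.add_monotone fun i j hij => ?_,
    fun k => ?_, fun k n hn => hφp k n ((Nat.le_add_right _ _).trans hn)⟩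
  · exact Finset.sum_le_sum_of_subset (Finset.range_mono hij)
  · have := hφ.monotone k.le_succ
    simp only [Finset.sum_range_succ, Nat.succ_eq_add_one] at this ⊢
    omega

theorem exists_seq_continuing_or_restarting (s : ℕ → ℝ) (Φ : ℕ → ℝ → ℝ) (I : ℕ → Prop) :
    ∃ (lam : ℕ → ℝ) (L : ℕ → ℕ),
      (∀ n, ¬I n → |s n| < L n ∧ lam n = s n + L n) ∧
      (∀ n, ¬I (n + 1) → Φ n (lam n) < lam (n + 1)) ∧
      ∀ n, I (n + 1) → L (n + 1) = L n ∧ lam (n + 1) = lam n + L n := by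
  have hrestart (n : ℕ) (b : ℝ) : ∃ m : ℕ, |s n| < m ∧ b < s n + m := by
    obtain ⟨m, hm⟩ := exists_nat_gt (|s n| + |b|)
    exact ⟨m, by linarith [abs_nonneg b], by linarith [neg_abs_le (s n), le_abs_self b]⟩
  choose m hsm hm using hrestart
  classical
  let next (n : ℕ) (p : ℝ × ℕ) : ℝ × ℕ :=
    if I (n + 1) then (p.1 + p.2, p.2)
    else (s (n + 1) + m (n + 1) (Φ n p.1), m (n + 1) (Φ n p.1))
  let state (n : ℕ) : ℝ × ℕ := Nat.rec (s 0 + m 0 0, m 0 0) next n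
  have hcontinue {n : ℕ} (hn : I (n + 1)) :
      state (n + 1) = ((state n).1 + (state n).2, (state n).2) := if_pos hn
  have hjump {n : ℕ} (hn : ¬I (n + 1)) : state (n + 1) =
      (s (n + 1) + m (n + 1) (Φ n (state n).1), m (n + 1) (Φ n (state n).1)) := if_neg hn
  refine ⟨fun n => (state n).1, fun n => (state n).2, fun n hn => ?_, fun n hn => ?_,
    fun n hn => ?_⟩
  · cases n with
    | zero => exact ⟨hsm 0 0, rfl⟩
    | succ n => simp only [hjump hn, hsm, and_self]
  · simp only [hjump hn, hm]
  · simp only [hcontinue hn, and_self]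

theorem eq_add_mul_of_continuing {lam L : ℕ → ℝ} {N M : ℕ}
    (h : ∀ j, j + 1 < M →
      L (N + j + 1) = L (N + j) ∧ lam (N + j + 1) = lam (N + j) + L (N + j)) :
    ∀ j < M, L (N + j) = L N ∧ lam (N + j) = lam N + L N * j := by
  intro j hj
  induction j with
  | zero => simp
  | succ j ih =>
    obtain ⟨hL, hlam⟩ := ih (by omega)
    obtain ⟨hL', hlam'⟩ := h j hj
    refine ⟨hL'.trans hL, hlam'.trans ?_⟩
    rw [hL, hlam]
    push_cast
    ring

theorem exists_seq_arithmetic_blocks {N M : ℕ → ℕ} (hN : StrictMono N)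
    (hNM : ∀ k, N k + M k ≤ N (k + 1)) (s : ℕ → ℝ) (Φ : ℕ → ℝ → ℝ) :
    ∃ (lam : ℕ → ℝ) (L : ℕ → ℕ), (∀ n, 0 < lam n) ∧ (∀ k, |s k| < L k) ∧
      (∀ k, ∀ j < M k, lam (N k + j) = s k + L k * ((j + 1 : ℕ) : ℝ)) ∧
      ∀ n, Φ n (lam n) < lam (n + 1) ∨ ∃ k j, n = N k + j ∧ j + 1 < M k := by
  let I (n : ℕ) : Prop := ∃ k, N k < n ∧ n < N k + M k
  have hNI (k : ℕ) : ¬I (N k) := by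
    rintro ⟨i, hik, hki⟩
    have hlt := hN.lt_iff_lt.1 hik
    have hle := hN.lt_iff_lt.1 (hki.trans_le (hNM i))
    omega
  obtain ⟨lam, L, hstart, hjump, hcontinue⟩ :=
    exists_seq_continuing_or_restarting (Function.extend N s 0) Φ I
  have hsL (k : ℕ) : |s k| < L (N k) ∧ lam (N k) = s k + L (N k) := by
    simpa only [hN.injective.extend_apply] using hstart (N k) (hNI k)
  have hblock (k j : ℕ) (hj : j < M k) :
      lam (N k + j) = s k + L (N k) * ((j + 1 : ℕ) : ℝ) := by
    rw [(eq_add_mul_of_continuing (lam := lam) (L := fun n => (L n : ℝ)) (M := M k)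
      (fun j hj => by simpa using hcontinue (N k + j) ⟨k, by omega, by omega⟩) j hj).2, (hsL k).2]
    push_cast
    ring
  have hpos (n : ℕ) : 0 < lam n := by
    by_cases hn : I n
    · obtain ⟨k, hk, hk'⟩ := hn
      obtain ⟨j, rfl⟩ := Nat.exists_eq_add_of_le hk.le
      rw [hblock k j (by omega)]
      push_cast
      nlinarith [neg_abs_le (s k), abs_nonneg (s k), (hsL k).1]
    · obtain ⟨hlt, heq⟩ := hstart n hn
      linarith [neg_abs_le (Function.extend N s 0 n)]
  refine ⟨lam, fun k => L (N k), hpos, fun k => (hsL k).1, hblock, fun n => ?_⟩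
  by_cases hn : I (n + 1)
  · obtain ⟨k, hk, hk'⟩ := hn
    obtain ⟨j, rfl⟩ := Nat.exists_eq_add_of_le (Nat.lt_succ_iff.1 hk)
    exact .inr ⟨k, j, rfl, by omega⟩
  · exact .inl (hjump n hn)

theorem exists_block_sequence {ε : ℕ → ℝ} (hε0 : ∀ n, 0 ≤ ε n) (hε : Tendsto ε atTop (𝓝 0))
    (s : ℕ → ℝ) (M : ℕ → ℕ) :
    ∃ (lam : ℕ → ℝ) (N L : ℕ → ℕ), (∀ n, 0 < lam n) ∧ (∀ n, lam n + 1 ≤ lam (n + 1)) ∧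
      (∀ n, (1 + ε n) * lam n < lam (n + 1)) ∧ StrictMono N ∧ (∀ k, L k ≠ 0) ∧
      ∀ k, ∀ j < M k, lam (N k + j) = s k + L k * ((j + 1 : ℕ) : ℝ) := by
  obtain ⟨N, hN, hNM, hεM⟩ := exists_strictMono_add_le (p := fun k n => ε n * M k < 1)
    (fun k => (hε.mul_const (M k : ℝ)).eventually_lt_const (by simp)) M
  obtain ⟨lam, L, hpos, hsL, hblock, hnext⟩ :=
    exists_seq_arithmetic_blocks hN hNM s fun n l => (1 + ε n) * l + 1
  have hL0 (k : ℕ) : L k ≠ 0 := by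
    have : (0 : ℝ) < L k := (abs_nonneg _).trans_lt (hsL k)
    exact_mod_cast this.ne'
  have hstep {k j : ℕ} (hj : j + 1 < M k) :
      lam (N k + j + 1) = lam (N k + j) + L k ∧ ε (N k + j) * lam (N k + j) < L k := by
    have hlam := hblock k j (by omega)
    have hL : (0 : ℝ) < L k := Nat.cast_pos.2 (Nat.pos_of_ne_zero (hL0 k))
    have hjM : ((j + 1 : ℕ) : ℝ) + 1 ≤ M k := by exact_mod_cast hj
    refine ⟨by rw [hlam, add_assoc, hblock k (j + 1) hj]; push_cast; ring, ?_⟩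
    calc ε (N k + j) * lam (N k + j) ≤ ε (N k + j) * (L k * M k) := by
          gcongr
          · exact hε0 _
          · rw [hlam]
            nlinarith [le_abs_self (s k), hsL k]
      _ = L k * (ε (N k + j) * M k) := by ring
      _ < L k := mul_lt_of_lt_one_right hL (hεM k _ (by omega))
  refine ⟨lam, N, L, hpos, fun n => ?_, fun n => ?_, hN, hL0, hblock⟩
  · rcases hnext n with hjump | ⟨k, j, rfl, hj⟩
    · nlinarith [hε0 n, hpos n]
    · rw [(hstep hj).1]
      gcongr
      exact_mod_cast Nat.one_le_iff_ne_zero.2 (hL0 k)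
  · rcases hnext n with hjump | ⟨k, j, rfl, hj⟩
    · linarith
    · linarith [hstep hj]

end Frequencies

section SmallCoefficients

variable {H : Type*} [NormedAddCommGroup H] [NormedSpace ℂ H] {u : ℕ → H}

/-- The subspace of vectors that can be approximated by linear combinations of arbitrarily late
terms of the system `u` with arbitrarily small `ℓ_q` norm of the coefficients, for every `q > 2`.
Using only late terms is what makes this a subspace: two approximants can be given disjoint
supports. -/
def smallCoeffApprox (u : ℕ → H) : Submodule ℂ H where
  carrier := {f | ∀ q : ℝ, 2 < q → ∀ ε : ℝ, 0 < ε → ∀ η : ℝ, 0 < η → ∀ n₀ : ℕ, ∃ c : ℕ →₀ ℂ,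
    (∀ n ∈ c.support, n₀ ≤ n) ∧ ‖f - c.sum fun n a => a • u n‖ < ε ∧
      (c.sum fun _ a => ‖a‖ ^ q) < η}
  zero_mem' q _ ε hε η hη n₀ := ⟨0, by simp, by simpa, by simpa⟩
  add_mem' := by
    intro f g hf hg q hq ε hε η hη n₀
    obtain ⟨c, hc, hfc, hcη⟩ := hf q hq _ (half_pos hε) _ (half_pos hη) n₀
    obtain ⟨d, hd, hgd, hdη⟩ :=
      hg q hq _ (half_pos hε) _ (half_pos hη) (max n₀ (c.support.sup id + 1))
    have hdisj : Disjoint c.support d.support := Finset.disjoint_left.2 fun n hnc hnd => by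
      have hle : n ≤ c.support.sup id := Finset.le_sup (f := id) hnc
      have hlt := (le_max_right _ _).trans (hd n hnd)
      omega
    refine ⟨c + d, fun n hn => ?_, ?_, ?_⟩
    · rcases Finset.mem_union.1 (Finsupp.support_add hn) with h | h
      · exact hc n h
      · exact (le_max_left _ _).trans (hd n h)
    · rw [Finsupp.sum_add_index_of_disjoint hdisj, add_sub_add_comm]
      linarith [norm_add_le (f - c.sum fun n a => a • u n) (g - d.sum fun n a => a • u n)]
    · rw [Finsupp.sum_add_index_of_disjoint hdisj]
      linarith
  smul_mem' := by
    intro a f hf q hq ε hε η hη n₀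
    have ha : 0 < ‖a‖ + 1 := by positivity
    have haq : 0 < (‖a‖ + 1) ^ q := by positivity
    obtain ⟨c, hc, hfc, hcη⟩ := hf q hq _ (div_pos hε ha) _ (div_pos hη haq) n₀
    rw [lt_div_iff₀ ha] at hfc
    rw [lt_div_iff₀ haq] at hcη
    refine ⟨a • c, fun n hn => hc n (Finsupp.support_smul hn), ?_, ?_⟩
    · rw [Finsupp.sum_smul_index (h := fun n b => b • u n) fun _ => zero_smul _ _]
      simp only [mul_smul]
      rw [← Finsupp.smul_sum, ← smul_sub, norm_smul]
      nlinarith [norm_nonneg (f - c.sum fun n a => a • u n)]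
    · rw [Finsupp.sum_smul_index fun _ => by rw [norm_zero, Real.zero_rpow (by linarith)]]
      refine lt_of_le_of_lt ?_ hcη
      rw [Finsupp.sum_mul]
      refine Finset.sum_le_sum fun n _ => ?_
      simp only [norm_mul]
      rw [Real.mul_rpow (norm_nonneg _) (norm_nonneg _), mul_comm]
      gcongr
      linarith

theorem isClosed_smallCoeffApprox : IsClosed (smallCoeffApprox u : Set H) := by
  refine isClosed_of_closure_subset fun f hf q hq ε hε η hη n₀ => ?_
  obtain ⟨g, hg, hfg⟩ := Metric.mem_closure_iff.1 hf _ (half_pos hε)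
  obtain ⟨c, hc, hgc, hcη⟩ := hg q hq _ (half_pos hε) η hη n₀
  rw [dist_eq_norm] at hfg
  exact ⟨c, hc, by linarith [norm_sub_le_norm_sub_add_norm_sub f g (c.sum fun n a => a • u n)],
    hcη⟩

theorem exists_norm_sub_lt_of_mem_smallCoeffApprox {f : H} (hf : f ∈ smallCoeffApprox u) {q : ℝ}
    (hq : 2 < q) {ε : ℝ} (hε : 0 < ε) :
    ∃ c : ℕ →₀ ℂ, ‖f - ∑ n ∈ c.support, c n • u n‖ < ε ∧
      (∑ n ∈ c.support, ‖c n‖ ^ q) ^ (1 / q) ≤ ‖f‖ := by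
  have hq0 : 0 < q := by linarith
  rcases eq_or_ne f 0 with rfl | hf0
  · exact ⟨0, by simpa, by simp [Real.zero_rpow (inv_ne_zero hq0.ne')]⟩
  · have hfpos : 0 < ‖f‖ := norm_pos_iff.2 hf0
    obtain ⟨c, -, hfc, hcf⟩ := hf q hq ε hε (‖f‖ ^ q) (by positivity) 0
    refine ⟨c, hfc, ?_⟩
    rw [one_div, Real.rpow_inv_le_iff_of_pos (by positivity) hfpos.le hq0]
    exact hcf.le

theorem mem_smallCoeffApprox_of_frequently {f : H} {P : ℕ → Polynomial ℂ} {N : ℕ → ℕ}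
    (hN : Tendsto N atTop atTop)
    (hP : ∀ q, 2 < q → Tendsto (fun k => lqSum q (P k)) atTop (𝓝 0))
    (happrox : ∀ ε > 0, ∃ᶠ k in atTop, ‖f - (P k).sum fun j a => a • u (N k + j)‖ < ε) :
    f ∈ smallCoeffApprox u := by
  intro q hq ε hε η hη n₀
  obtain ⟨k, hfk, hkη, hk⟩ := ((happrox ε hε).and_eventually
    (((hP q hq).eventually_lt_const hη).and (hN.eventually_ge_atTop n₀))).exists
  refine ⟨(P k).toFinsupp.coeff.embDomain (addLeftEmbedding (N k)), fun n hn => ?_,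
    by rwa [Finsupp.sum_embDomain], by rwa [Finsupp.sum_embDomain]⟩
  rw [Finsupp.support_embDomain] at hn
  obtain ⟨j, -, rfl⟩ := Finset.mem_map.1 hn
  exact hk.trans (Nat.le_add_right _ _)

end SmallCoefficients

section Assembly

theorem pairwise_le_abs_sub_of_add_le_succ {lam : ℕ → ℝ} {δ : ℝ} (hδ : 0 ≤ δ)
    (hgap : ∀ n, lam n + δ ≤ lam (n + 1)) : Pairwise fun m n => δ ≤ |lam m - lam n| := by
  have hmono : Monotone lam := monotone_nat_of_le_succ fun n => by linarith [hgap n]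
  have hlt {m n : ℕ} (hmn : m < n) : δ ≤ lam n - lam m := by
    linarith [hgap m, hmono (Nat.succ_le_of_lt hmn)]
  intro m n hmn
  rcases hmn.lt_or_gt with h | h
  · rw [abs_sub_comm]
    exact (hlt h).trans (le_abs_self _)
  · exact (hlt h).trans (le_abs_self _)

theorem uniformlyDiscrete_range {ι : Type*} {lam : ι → ℝ} {δ : ℝ} (hδ : 0 < δ)
    (hsep : Pairwise fun m n => δ ≤ |lam m - lam n|) : UniformlyDiscrete (Set.range lam) := by
  refine ⟨δ, hδ, ?_⟩
  rintro _ ⟨m, rfl⟩ _ ⟨n, rfl⟩ hmn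
  exact hsep (ne_of_apply_ne lam hmn)

theorem frequently_unpair_fst_eq (i : ℕ) : ∃ᶠ k in atTop, (Nat.unpair k).1 = i :=
  frequently_atTop.2 fun k => ⟨Nat.pair i k, Nat.right_le_pair i k, by rw [Nat.unpair_pair]⟩

theorem smallCoeffApprox_expL2_eq_top {w : ℝ → ℝ} (hw : IsWeight w) {P : ℕ → Polynomial ℂ}
    (hP : ∀ q, 2 < q → Tendsto (fun k => lqSum q (P k)) atTop (𝓝 0)) {η : ℕ → ℝ}
    (hη : Tendsto η atTop (𝓝 0)) {L : ℕ → ℕ}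
    (happrox : ∀ k s, ‖expL2 hw (2 * Real.pi * s) - (P k).sum fun j a =>
      a • expL2 hw (2 * Real.pi * (s + L k * ((j + 1 : ℕ) : ℝ)))‖ ^ 2 ≤ η k)
    {σ : ℕ → ℝ} (hσ : DenseRange σ) {lam : ℕ → ℝ} {N : ℕ → ℕ} (hN : Tendsto N atTop atTop)
    (hblock : ∀ k, ∀ j < (P k).natDegree + 1,
      lam (N k + j) = σ (Nat.unpair k).1 + L k * ((j + 1 : ℕ) : ℝ)) :
    smallCoeffApprox (fun n => expL2 hw (2 * Real.pi * lam n)) = ⊤ := by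
  rw [eq_top_iff, ← span_expL2_topologicalClosure_eq_top hw hσ]
  refine Submodule.topologicalClosure_minimal _ (Submodule.span_le.2 ?_) isClosed_smallCoeffApprox
  rintro _ ⟨i, rfl⟩
  refine mem_smallCoeffApprox_of_frequently hN hP fun ε hε => ?_
  refine ((frequently_unpair_fst_eq i).and_eventually
    (hη.eventually_lt_const (pow_pos hε 2))).mono ?_
  rintro k ⟨rfl, hk⟩
  have hsum : ((P k).sum fun j a => a • expL2 hw (2 * Real.pi * lam (N k + j))) =
      (P k).sum fun j a =>
        a • expL2 hw (2 * Real.pi * (σ (Nat.unpair k).1 + L k * ((j + 1 : ℕ) : ℝ))) :=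
    Finset.sum_congr rfl fun j hj => by
      simp only [hblock k j (Nat.lt_succ_of_le (Polynomial.le_natDegree_of_mem_supp j hj))]
  rw [hsum]
  exact lt_of_pow_lt_pow_left₀ 2 hε.le ((happrox k _).trans_lt hk)

theorem isQFSystem_of_smallCoeffApprox_eq_top {H : Type*} [NormedAddCommGroup H]
    [InnerProductSpace ℂ H] {u : ℕ → H} (htop : smallCoeffApprox u = ⊤)
    (hbessel : ∃ C : ℝ, ∀ f : H, Summable (fun n => ‖inner ℂ f (u n)‖ ^ 2) ∧
      √(∑' n, ‖inner ℂ f (u n)‖ ^ 2) ≤ C * ‖f‖) : IsQFSystem u := by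
  refine ⟨fun q hq => ⟨1, fun f ε hε => ?_⟩, hbessel⟩
  rw [one_mul]
  exact exists_norm_sub_lt_of_mem_smallCoeffApprox (htop ▸ Submodule.mem_top) hq hε

end Assembly

theorem theorem3 (ε : ℕ → ℝ) (hε_pos : ∀ n, 0 < ε n) (hε_lim : Tendsto ε atTop (𝓝 0)) :
    ∃ (w : ℝ → ℝ) (hw : IsWeight w) (lam : ℕ → ℝ),
      (∀ n, 0 < lam n) ∧
      UniformlyDiscrete (Set.range lam) ∧
      (∀ n, lam (n + 1) / lam n > 1 + ε n) ∧
      IsQFSystem (fun n => expL2 hw (lam n)) := by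
  obtain ⟨P, hP, hPvol⟩ := exists_seq_lqSum_tendsto_zero
  have hsum := ne_top_of_le_ne_top summable_geometric_two.tsum_ofReal_ne_top
    (ENNReal.tsum_le_tsum fun k => (hPvol k).le)
  obtain ⟨lam, N, L, hpos, hgap, hratio, hN, hL, hblock⟩ :=
    exists_block_sequence (fun n => (hε_pos n).le) hε_lim
      (fun k => TopologicalSpace.denseSeq ℝ (Nat.unpair k).1) fun k => (P k).natDegree + 1
  obtain ⟨w, hw, hwle, happrox⟩ :=
    exists_isWeight_norm_sq_le (fun k => by positivity) hsum hL isWeight_gaussian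
  have hlim : Tendsto (fun k => (((1 : ℝ) / 2) ^ k) ^ 2 * ∫ x, Real.exp (-x ^ 2)) atTop (𝓝 0) := by
    simpa using ((tendsto_pow_atTop_nhds_zero_of_lt_one (by norm_num)
      one_half_lt_one).pow 2).mul_const (∫ x : ℝ, Real.exp (-x ^ 2))
  have htop := smallCoeffApprox_expL2_eq_top hw hP hlim happrox
    (TopologicalSpace.denseRange_denseSeq ℝ) hN.tendsto_atTop hblock
  have hsep := pairwise_le_abs_sub_of_add_le_succ (lam := fun n => 2 * Real.pi * lam n)
    Real.two_pi_pos.le fun n => by nlinarith [hgap n, Real.pi_pos]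
  refine ⟨w, hw, fun n => 2 * Real.pi * lam n, fun n => mul_pos Real.two_pi_pos (hpos n),
    uniformlyDiscrete_range Real.two_pi_pos hsep, fun n => ?_,
    isQFSystem_of_smallCoeffApprox_eq_top htop (exists_bessel_bound hw hwle Real.two_pi_pos hsep)⟩
  rw [mul_div_mul_left _ _ Real.two_pi_pos.ne', gt_iff_lt, lt_div_iff₀ (hpos n)]
  exact hratio n
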